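/- All graphs are finite, undirected and simple; eigenvalues of a graph are those of its adjacency matrix, $I$ is an identity matrix and $J$ an all-ones matrix. For $\theta_0>\theta_1>\theta_2$ let $\mathscr G_3(\theta_0,\theta_1,\theta_2)$ be the set of connected graphs whose distinct eigenvalues are exactly $\theta_0,\theta_1,\theta_2$. A coherent algebra is a subalgebra of $\mathrm{Mat}_V(\mathbb C)$ containing $I$ and $J$ and closed under transposition and entrywise product; it has a unique basis of $\{0,1\}$-matrices, which are the matrices of the relations $R_1,\dots,R_s$ of a coherent configuration on $V$. Its fibres are the sets $\{u:(u,u)\in R_i\}$ for those $R_i$ contained in the diagonal, and, for an ordering $F_1,\dots,F_d$ of the fibres, its type is the symmetric matrix whose $(i,j)$-entry is the number of relations contained in $F_i\times F_j$. The coherent closure $\mathcal W(\Gamma)$ of a graph $\Gamma$ is the smallest coherent algebra containing its adjacency matrix $A(\Gamma)$. A quasi-symmetric design (QSD) with parameters $(v,k,\lambda;b,r,\{x,y\})$ consists of $v$ points and a family of $b$ blocks (repetitions allowed), each a set of $k$ points, $1\le k\le v$, such that every point is in exactly $r$ blocks, every pair of points is in exactly $\lambda$ blocks, and any two blocks of the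 family meet in $x$ or $y$ points, where $x\neq y$ and both numbers occur. Its incidence matrix has rows indexed by points and columns by blocks. Its $x$-block graph $\mathsf B_x(\mathcal Q)$ has the blocks as vertices, two distinct blocks being adjacent when they meet in $x$ points. An eigenvalue of a graph is restricted if it has an eigenvector orthogonal to the all-ones vector. **Theorem.** Let $\Gamma\in\mathscr G_3(\theta_0,\theta_1,\theta_2)$ be such that $\mathcal W(\Gamma)$ has type $\left[\begin{smallmatrix}2&2\\&3\end{smallmatrix}\right]$ with respect to its fibres $V_1,V_2$ (in this order; the omitted entry is given by symmetry). Then: (i) $\Gamma$ is biregular with degrees $k_1\ne k_2$ and valency partition $\{V_1,V_2\}$ (the vertices in $V_i$ are those of degree $k_i$), and this partition is equitable with some quotient matrix $\left[\begin{smallmatrix}k_{11}&k_{12}\\k_{21}&k_{22}\end{smallmatrix}\right]$, that is, each vertex of $V_i$ has exactly $k_{ij}$ neighbours in $V_j$. Write $n_i=|V_i|$. (ii) With respect to $V_1,V_2$, $$A(\Gamma)=\begin{bmatrix}\varepsilon(J-I)&M\\M^\top&A(\Gamma[V_2])\end{bmatrix}$$ with $\varepsilon\in\{0,1\}$, where $M$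 is the incidence matrix of a QSD $\mathcal Q$ with point set $V_1$, blocks indexed by $V_2$, and parameters $(n_1,k_{21},\lambda;n_2,k_{12},\{x,y\})$, and $\Gamma[V_2]=\mathsf B_x(\mathcal Q)$. (iii) $\mathsf B_x(\mathcal Q)$ has exactly two restricted eigenvalues $e_1>e_2$, and either $\theta_1=e_1=\frac{y-k_{21}}{x-y}$ or $\theta_2=e_2=\frac{y-k_{21}}{x-y}$. Furthermore, $$x=k_{21}+(\theta_1+1)(\theta_2+1)-(e_1+1)(e_2+1),\qquad y=k_{21}+\theta_1\theta_2-e_1e_2,$$ the numbers $k_1+\theta_1\theta_2$ and $k_2+\theta_1\theta_2$ are positive, and: * if $\Gamma[V_1]$ is empty, then $$\lambda-k_{12}=\theta_1\theta_2,\quad \frac{k_{12}-\lambda+y-k_{21}}{x-y}=\theta_1+\theta_2,\quad \sqrt{(k_1+\theta_1\theta_2)(k_2+\theta_1\theta_2)}=\frac{\lambda k_{21}-yk_{12}}{x-y};$$ * if $\Gamma[V_1]$ is complete, then $$\lambda-k_{12}=(\theta_1+1)(\theta_2+1),\quad \frac{k_{12}-\lambda+y-k_{21}}{x-y}=\theta_1+\theta_2+1,\quad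 \sqrt{(k_1+\theta_1\theta_2)(k_2+\theta_1\theta_2)}=k_{21}+\frac{\lambda k_{21}-yk_{12}}{x-y}.$$ -/

import Mathlib

open scoped Matrix

/-! ### Graphs with three distinct eigenvalues -/

/-- `Γ` is a connected graph whose distinct (adjacency) eigenvalues are exactly
`θ₀ > θ₁ > θ₂`. -/
structure InG3 {V : Type*} [Fintype V] [DecidableEq V] (Γ : SimpleGraph V)
    [DecidableRel Γ.Adj] (θ₀ θ₁ θ₂ : ℝ) : Prop where
  lt₀₁ : θ₁ < θ₀
  lt₁₂ : θ₂ < θ₁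
  connected : Γ.Connected
  spectrum_eq : spectrum ℝ (Γ.adjMatrix ℝ) = {θ₀, θ₁, θ₂}

/-- The restricted eigenvalues of a graph: those having an eigenvector orthogonal to the
all-ones vector. -/
def restrictedEigenvalues {W : Type*} [Fintype W] (G : SimpleGraph W) [DecidableRel G.Adj] :
    Set ℝ :=
  {e | ∃ u : W → ℝ, u ≠ 0 ∧ ∑ w, u w = 0 ∧ G.adjMatrix ℝ *ᵥ u = e • u}

/-- `{V₁, V₂}` is the valency partition of the biregular graph `Γ`: the vertices of degree `k₁`
are exactly those in `V₁`, the vertices of degree `k₂ ≠ k₁` are exactly those in `V₂`, both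
degrees occur, and no other degree does. -/
structure IsBiregular {V : Type*} [Fintype V] (Γ : SimpleGraph V) [DecidableRel Γ.Adj]
    (V₁ V₂ : Finset V) (k₁ k₂ : ℕ) : Prop where
  ne : k₁ ≠ k₂
  nonempty₁ : V₁.Nonempty
  nonempty₂ : V₂.Nonempty
  cover : ∀ u, u ∈ V₁ ∨ u ∈ V₂
  mem₁ : ∀ u, u ∈ V₁ ↔ Γ.degree u = k₁
  mem₂ : ∀ u, u ∈ V₂ ↔ Γ.degree u = k₂

/-- Every vertex of `P i` has exactly `q i j` neighbours in `P j`. (For a partition `P` this says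
that it is equitable with quotient matrix `q`.) -/
def IsEquitableWith {V : Type*} [Fintype V] [DecidableEq V] (Γ : SimpleGraph V)
    [DecidableRel Γ.Adj] {d : ℕ} (P : Fin d → Finset V) (q : Matrix (Fin d) (Fin d) ℕ) : Prop :=
  ∀ i j, ∀ u ∈ P i, (Γ.neighborFinset u ∩ P j).card = q i j

/-! ### Coherent algebras and coherent configurations -/

/-- A coherent algebra: a matrix algebra over `ℂ` (it contains `I`, being a unital subalgebra)
containing the all-ones matrix, closed under transposition and entrywise product. -/
structure IsCoherentAlgebra {V : Type*} [Fintype V] [DecidableEq V]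
    (S : Subalgebra ℂ (Matrix V V ℂ)) : Prop where
  ones_mem : (Matrix.of fun _ _ => 1 : Matrix V V ℂ) ∈ S
  transpose_mem : ∀ M ∈ S, Mᵀ ∈ S
  hadamard_mem : ∀ M ∈ S, ∀ N ∈ S, M ⊙ N ∈ S

/-- The coherent closure of a graph: the smallest coherent algebra containing its adjacency
matrix. -/
def coherentClosure {V : Type*} [Fintype V] [DecidableEq V] (Γ : SimpleGraph V)
    [DecidableRel Γ.Adj] : Subalgebra ℂ (Matrix V V ℂ) :=
  sInf {S | IsCoherentAlgebra S ∧ Γ.adjMatrix ℂ ∈ S}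

theorem coherentClosure_isLeast {V : Type*} [Fintype V] [DecidableEq V] (Γ : SimpleGraph V)
    [DecidableRel Γ.Adj] :
    IsLeast {S | IsCoherentAlgebra S ∧ Γ.adjMatrix ℂ ∈ S} (coherentClosure Γ) := by
  refine ⟨⟨⟨?_, ?_, ?_⟩, ?_⟩, fun S hS => sInf_le hS⟩
  · exact Algebra.mem_sInf.2 fun S hS => hS.1.ones_mem
  · exact fun M hM => Algebra.mem_sInf.2 fun S hS =>
      hS.1.transpose_mem M (Algebra.mem_sInf.1 hM S hS)
  · exact fun M hM N hN => Algebra.mem_sInf.2 fun S hS =>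
      hS.1.hadamard_mem M (Algebra.mem_sInf.1 hM S hS) N (Algebra.mem_sInf.1 hN S hS)
  · exact Algebra.mem_sInf.2 fun S hS => hS.2

/-- The `0-1` matrix of a binary relation. -/
def relMatrix {V : Type*} [DecidableEq V] (R : Finset (V × V)) : Matrix V V ℂ :=
  Matrix.of fun u w => if (u, w) ∈ R then 1 else 0

/-- A coherent configuration on `V`: a set of (non-empty) binary relations whose matrices sum to
the all-ones matrix, are closed under transposition, have a subset with sum the identity, and
whose products are combinations of them. -/
structure CoherentConfiguration (V : Type*) [Fintype V] [DecidableEq V] where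
  rels : Finset (Finset (V × V))
  nonempty_of_mem : ∀ R ∈ rels, R.Nonempty
  sum_eq_ones : ∑ R ∈ rels, relMatrix R = Matrix.of fun _ _ => 1
  transpose_mem : ∀ R ∈ rels, ∃ R' ∈ rels, (relMatrix R)ᵀ = relMatrix R'
  exists_diagonal : ∃ Δ ⊆ rels, ∑ R ∈ Δ, relMatrix R = 1
  mul_eq : ∀ R ∈ rels, ∀ R' ∈ rels, ∃ p : Finset (V × V) → ℂ,
    relMatrix R * relMatrix R' = ∑ T ∈ rels, p T • relMatrix T

namespace CoherentConfiguration

variable {V : Type*} [Fintype V] [DecidableEq V]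

/-- The fibres: the sets `{u | (u, u) ∈ R}`, where `R` is a relation of the configuration that is
contained in the diagonal. -/
def fibres (C : CoherentConfiguration V) : Set (Finset V) :=
  {F | ∃ R ∈ C.rels, (∀ p ∈ R, p.1 = p.2) ∧ ∀ u, u ∈ F ↔ (u, u) ∈ R}

/-- The number of relations of the configuration that are contained in `F × G`. -/
def typeEntry (C : CoherentConfiguration V) (F G : Finset V) : ℕ :=
  (C.rels.filter fun R => R ⊆ F ×ˢ G).card

/-- `F` lists the fibres of `C` without repetition, and with respect to this ordering of the
fibres the type of `C` is the matrix `T`. -/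
structure HasType (C : CoherentConfiguration V) {d : ℕ} (F : Fin d → Finset V)
    (T : Matrix (Fin d) (Fin d) ℕ) : Prop where
  injective : Function.Injective F
  range_eq : Set.range F = C.fibres
  typeEntry_eq : ∀ i j, C.typeEntry (F i) (F j) = T i j

/-- `C` is the coherent configuration of the algebra `S`: the matrices of the relations of `C`
form a basis of `S`. -/
structure IsConfigurationOf (C : CoherentConfiguration V) (S : Subalgebra ℂ (Matrix V V ℂ)) :
    Prop where
  linearIndependent : LinearIndependent ℂ fun R : C.rels => relMatrix R.1
  span_eq : Submodule.span ℂ (Set.range fun R : C.rels => relMatrix R.1) =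
    Subalgebra.toSubmodule S

end CoherentConfiguration

theorem relMatrix_apply {V : Type*} [DecidableEq V] (R : Finset (V × V)) (u w : V) :
    relMatrix R u w = if (u, w) ∈ R then 1 else 0 := rfl

/-- Every coherent algebra has a coherent configuration. -/
theorem exists_isConfigurationOf {V : Type*} [Fintype V] [DecidableEq V]
    (S : Subalgebra ℂ (Matrix V V ℂ)) (hS : IsCoherentAlgebra S) :
    ∃ C : CoherentConfiguration V, C.IsConfigurationOf S := by
  classical
  -- the relation containing `p`: all pairs that no matrix in `S` separates from `p`
  let cl : V × V → Finset (V × V) := fun p =>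
    Finset.univ.filter fun q => ∀ M ∈ S, M q.1 q.2 = M p.1 p.2
  have mem_cl : ∀ p q, q ∈ cl p ↔ ∀ M ∈ S, M q.1 q.2 = M p.1 p.2 := fun p q => by simp [cl]
  have self_mem : ∀ p, p ∈ cl p := fun p => (mem_cl p p).2 fun _ _ => rfl
  have cl_eq : ∀ p q, q ∈ cl p → cl q = cl p := by
    intro p q h
    rw [mem_cl] at h
    ext t
    rw [mem_cl, mem_cl]
    exact ⟨fun H M hM => (H M hM).trans (h M hM), fun H M hM => (H M hM).trans (h M hM).symm⟩
  have sep : ∀ p q, q ∉ cl p → ∃ N ∈ S, N p.1 p.2 = 1 ∧ N q.1 q.2 = 0 := by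
    intro p q h
    rw [mem_cl] at h
    push Not at h
    obtain ⟨M, hM, hne⟩ := h
    refine ⟨(M p.1 p.2 - M q.1 q.2)⁻¹ •
      (M - M q.1 q.2 • (Matrix.of fun _ _ => 1 : Matrix V V ℂ)), ?_, ?_, ?_⟩
    · exact S.smul_mem (S.sub_mem hM (S.smul_mem hS.ones_mem _)) _
    · have : M p.1 p.2 - M q.1 q.2 ≠ 0 := sub_ne_zero.2 (Ne.symm hne)
      simp [this]
    · simp
  have key : ∀ p, ∀ T : Finset (V × V), (∀ q ∈ T, q ∉ cl p) →
      ∃ N ∈ S, N p.1 p.2 = 1 ∧ ∀ q ∈ T, N q.1 q.2 = 0 := by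
    intro p T
    induction T using Finset.induction_on with
    | empty => exact fun _ => ⟨_, hS.ones_mem, rfl, by simp⟩
    | insert a T _ ih =>
      intro h
      obtain ⟨N, hN, h1, h0⟩ := ih fun q hq => h q (Finset.mem_insert_of_mem hq)
      obtain ⟨N', hN', h1', h0'⟩ := sep p a (h a (Finset.mem_insert_self _ _))
      refine ⟨N ⊙ N', hS.hadamard_mem _ hN _ hN', by simp [h1, h1'], ?_⟩
      intro q hq
      rcases Finset.mem_insert.1 hq with rfl | hq
      · simp [h0']
      · simp [h0 q hq]
  have ind_mem : ∀ p, relMatrix (cl p) ∈ S := by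
    intro p
    obtain ⟨N, hN, h1, h0⟩ := key p (cl p)ᶜ (by simp)
    convert hN using 1
    ext u w
    rw [relMatrix_apply]
    split_ifs with h
    · rw [← h1]; exact ((mem_cl p (u, w)).1 h N hN).symm
    · exact (h0 (u, w) (by simpa using h)).symm
  let rels : Finset (Finset (V × V)) := Finset.univ.image cl
  have mem_rels : ∀ R, R ∈ rels ↔ ∃ p, cl p = R := fun R => by simp [rels]
  have eq_cl : ∀ R ∈ rels, ∀ p ∈ R, R = cl p := by
    intro R hR p hp
    obtain ⟨q, rfl⟩ := (mem_rels R).1 hR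
    exact (cl_eq q p hp).symm
  have cl_mem : ∀ p, cl p ∈ rels := fun p => (mem_rels _).2 ⟨p, rfl⟩
  -- entries of combinations of the relation matrices
  have entry : ∀ (f : Finset (V × V) → ℂ) (u w : V),
      (∑ R ∈ rels, f R • relMatrix R) u w = f (cl (u, w)) := by
    intro f u w
    rw [Matrix.sum_apply, Finset.sum_eq_single (cl (u, w))]
    · simp [relMatrix_apply, self_mem]
    · intro R hR hne
      have : (u, w) ∉ R := fun h => hne (eq_cl R hR _ h)
      simp [relMatrix_apply, this]
    · exact fun h => absurd (cl_mem _) h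
  have rep_fun : ∀ M ∈ S, ∃ f : Finset (V × V) → ℂ, M = ∑ R ∈ rels, f R • relMatrix R := by
    intro M hM
    refine ⟨fun R => if h : R.Nonempty then M h.choose.1 h.choose.2 else 0, ?_⟩
    ext u w
    rw [entry]
    have h : (cl (u, w)).Nonempty := ⟨_, self_mem _⟩
    simp only [h, dite_true]
    exact ((mem_cl _ _).1 h.choose_spec M hM).symm
  let C : CoherentConfiguration V :=
    { rels := rels
      nonempty_of_mem := by
        intro R hR
        obtain ⟨p, rfl⟩ := (mem_rels R).1 hR
        exact ⟨p, self_mem p⟩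
      sum_eq_ones := by
        ext u w
        have := entry (fun _ => 1) u w
        simpa using this
      transpose_mem := by
        intro R hR
        obtain ⟨p, rfl⟩ := (mem_rels R).1 hR
        refine ⟨cl p.swap, cl_mem _, ?_⟩
        ext u w
        have : (w, u) ∈ cl p ↔ (u, w) ∈ cl p.swap := by
          rw [mem_cl, mem_cl]
          exact ⟨fun h M hM => h Mᵀ (hS.transpose_mem M hM),
            fun h M hM => h Mᵀ (hS.transpose_mem M hM)⟩
        simp only [Matrix.transpose_apply, relMatrix_apply, this]
      exists_diagonal := by
        refine ⟨rels.filter fun R => ∀ p ∈ R, p.1 = p.2, Finset.filter_subset _ _, ?_⟩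
        have h := entry (fun R => if ∀ p ∈ R, p.1 = p.2 then 1 else 0)
        ext u w
        rw [Finset.sum_filter, show (∑ R ∈ rels, if ∀ p ∈ R, p.1 = p.2 then relMatrix R else 0) =
          ∑ R ∈ rels, (if ∀ p ∈ R, p.1 = p.2 then (1 : ℂ) else 0) • relMatrix R from
            Finset.sum_congr rfl fun R _ => by split_ifs <;> simp, h, Matrix.one_apply]
        refine if_congr ⟨fun H => H _ (self_mem _), ?_⟩ rfl rfl
        rintro rfl p hp
        have := (mem_cl _ _).1 hp 1 S.one_mem
        by_contra hne
        simp [Matrix.one_apply, hne] at this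
      mul_eq := by
        intro R hR R' hR'
        obtain ⟨p, rfl⟩ := (mem_rels R).1 hR
        obtain ⟨q, rfl⟩ := (mem_rels R').1 hR'
        exact rep_fun _ (S.mul_mem (ind_mem p) (ind_mem q)) }
  refine ⟨C, ?_, ?_⟩
  · rw [Fintype.linearIndependent_iff]
    intro g hg R
    obtain ⟨p, hp⟩ := (mem_rels R.1).1 R.2
    have h2 : ∑ R ∈ rels, (if h : R ∈ rels then g ⟨R, h⟩ else 0) • relMatrix R = 0 := by
      rw [← hg, ← Finset.sum_coe_sort]
      exact Finset.sum_congr rfl fun R _ => by simp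
    have h3 := entry (fun R => if h : R ∈ rels then g ⟨R, h⟩ else 0) p.1 p.2
    rw [h2] at h3
    have h4 : cl (p.1, p.2) = R.1 := hp
    rw [h4] at h3
    simpa [R.2] using h3.symm
  · apply le_antisymm
    · rw [Submodule.span_le]
      rintro _ ⟨R, rfl⟩
      obtain ⟨p, hp⟩ := (mem_rels R.1).1 R.2
      change relMatrix R.1 ∈ S
      rw [← hp]
      exact ind_mem p
    · intro M hM
      obtain ⟨f, rfl⟩ := rep_fun M hM
      exact Submodule.sum_mem _ fun R hR => Submodule.smul_mem _ _
        (Submodule.subset_span ⟨⟨R, hR⟩, rfl⟩)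

/-! ### Quasi-symmetric designs -/

/-- The family of blocks `blk : B → Finset P` (repetitions allowed) is a `2-(v, k, lam)` design
on the point set `P`. -/
structure IsTwoDesign {P B : Type*} [Fintype P] [DecidableEq P] [Fintype B]
    (blk : B → Finset P) (v k lam : ℕ) : Prop where
  card_points : Fintype.card P = v
  one_le : 1 ≤ k
  le : k ≤ v
  card_block : ∀ j, (blk j).card = k
  card_pair : ∀ s : Finset P, s.card = 2 →
    (Finset.univ.filter fun j => s ⊆ blk j).card = lam

/-- A quasi-symmetric design with parameters `(v, k, lam; b, r, {x, y})`: a `2-(v, k, lam)` design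
with `b` blocks, with `r` blocks through each point, such that any two blocks meet in `x` or `y`
points, where `x ≠ y` and both intersection sizes occur. -/
structure IsQSD {P B : Type*} [Fintype P] [DecidableEq P] [Fintype B]
    (blk : B → Finset P) (v k lam b r x y : ℕ) : Prop extends IsTwoDesign blk v k lam where
  card_blocks : Fintype.card B = b
  card_through : ∀ p, (Finset.univ.filter fun j => p ∈ blk j).card = r
  ne : x ≠ y
  inter : ∀ i j, i ≠ j → (blk i ∩ blk j).card = x ∨ (blk i ∩ blk j).card = y
  exists_x : ∃ i j, i ≠ j ∧ (blk i ∩ blk j).card = x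
  exists_y : ∃ i j, i ≠ j ∧ (blk i ∩ blk j).card = y

/-- The incidence matrix of a family of blocks: rows are points, columns are blocks. -/
def incidenceMatrix {P B : Type*} [DecidableEq P] (blk : B → Finset P) : Matrix P B ℝ :=
  Matrix.of fun p j => if p ∈ blk j then 1 else 0

/-- The `x`-block graph: two distinct blocks are adjacent when they meet in `x` points. -/
def blockGraph {P B : Type*} [DecidableEq P] (blk : B → Finset P) (x : ℕ) : SimpleGraph B where
  Adj i j := i ≠ j ∧ (blk i ∩ blk j).card = x
  symm := ⟨fun i j h => ⟨h.1.symm, by rw [Finset.inter_comm]; exact h.2⟩⟩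
  loopless := ⟨fun i h => h.1 rfl⟩

instance {P B : Type*} [DecidableEq P] [DecidableEq B] (blk : B → Finset P) (x : ℕ) :
    DecidableRel (blockGraph blk x).Adj :=
  fun i j => inferInstanceAs (Decidable (i ≠ j ∧ (blk i ∩ blk j).card = x))

/-! ### Perron vector of a graph with three eigenvalues -/

section Perron

/-! The eigenvalue `θ₀` is simple with a positive eigenvector, so `(A - θ₁)(A - θ₂)` has rank one
and equals `a aᵀ` with `a > 0` (`InG3.exists_pos`). The diagonal reads `deg u + θ₁θ₂ = (a u)²`.
Hence `a` is a function of the degree and is constant on fibres. If both fibres had the same degree,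
`A²` would lie in the span of `A`, `I`, `J`; that span would be a coherent algebra with constant
diagonals, which leaves room for only one fibre.

The coherent closure is minimal, so a coherent algebra that contains `A` cannot be proper in it. If
adjacency did not separate the two relations between the fibres, or the two non-diagonal relations
inside the second fibre, the matrices constant on the offending positions would form such a proper
algebra (`exists_adj_not_adj`, `exists_adj_not_adj_of_three`). The second case needs `A² = (θ₁ +
θ₂)A - θ₁θ₂ I + a aᵀ` as well. So adjacency determines the relations in each block, and the numbers
of common neighbours in a fibre become the design parameters `lam`, `x`, `y`
(`exists_twoFibreGraph`).

The rest is matrix algebra on the blocks `ε(J - I)`, `M`, `B` of `A`. The three blocks of the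
identity for `A²` give `λ - k₁₂ = (θ₁ + ε)(θ₂ + ε)`, a formula for `MB`, and one for `B² + MᵀM`.
Evaluating `MMᵀM` in two ways yields the remaining parameter equations. Since `MᵀM` is a combination
of `I`, `B`, `J`, the matrix `B` is quadratic modulo `J` and has two restricted eigenvalues, whose
sum and product give `x` and `y`. An eigenvector of `B` orthogonal to the all-ones vector is either
killed by `M`, and then its eigenvalue is `θ₁` or `θ₂`, or mapped to an eigenvector of `MMᵀ`, and
then its eigenvalue is `θ₁ + θ₂ + ε`. The sign `λ ≤ k₁₂` excludes `e₁ = θ₂` and `e₂ = θ₁`. -/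

theorem isHermitian_adjMatrix_real {V : Type*} (Γ : SimpleGraph V) [DecidableRel Γ.Adj] :
    (Γ.adjMatrix ℝ).IsHermitian := by
  rw [Matrix.IsHermitian, Matrix.conjTranspose_eq_transpose_of_trivial]
  exact Γ.isSymm_adjMatrix

variable {V : Type*} [Fintype V] [DecidableEq V] {Γ : SimpleGraph V} [DecidableRel Γ.Adj]
  {θ₀ θ₁ θ₂ : ℝ}

/-- The polynomial vanishes on the spectrum and `A` is symmetric, so the continuous functional
calculus sends it to zero. -/
theorem InG3.cubic (h : InG3 Γ θ₀ θ₁ θ₂) :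
    (Γ.adjMatrix ℝ - θ₀ • 1) * ((Γ.adjMatrix ℝ - θ₁ • 1) * (Γ.adjMatrix ℝ - θ₂ • 1)) = 0 := by
  have hA : IsSelfAdjoint (Γ.adjMatrix ℝ) := isHermitian_adjMatrix_real Γ
  let p : Polynomial ℝ := (.X - .C θ₀) * ((.X - .C θ₁) * (.X - .C θ₂))
  have h1 := cfc_polynomial p (Γ.adjMatrix ℝ) hA
  have h2 : cfc p.eval (Γ.adjMatrix ℝ) = cfc (fun _ => (0 : ℝ)) (Γ.adjMatrix ℝ) := by
    apply cfc_congr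
    intro t ht
    rw [h.spectrum_eq] at ht
    rcases ht with rfl | rfl | rfl <;> simp [p]
  rw [h1, cfc_const_zero] at h2
  simpa [p, Algebra.algebraMap_eq_smul_one] using h2

theorem InG3.posSemidef (h : InG3 Γ θ₀ θ₁ θ₂) :
    (θ₀ • (1 : Matrix V V ℝ) - Γ.adjMatrix ℝ).PosSemidef := by
  rw [Matrix.posSemidef_iff_isHermitian_and_spectrum_nonneg]
  refine ⟨(Matrix.isHermitian_one.smul (k := θ₀) (by simp [IsSelfAdjoint])).sub
    (isHermitian_adjMatrix_real Γ), ?_⟩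
  rw [← Algebra.algebraMap_eq_smul_one, ← spectrum.singleton_sub_eq, h.spectrum_eq]
  rintro _ ⟨a, rfl, t, ht, rfl⟩
  have := h.lt₀₁
  have := h.lt₁₂
  simp only [Set.mem_ofPred_eq]
  rcases ht with rfl | rfl | rfl <;> linarith

/-- Passing to absolute values keeps the norm and does not decrease the quadratic form of `A`. The
form of the semidefinite matrix `θ₀ I - A` is zero at `z`, hence also at `|z|`, and a zero of a
semidefinite form lies in the kernel. -/
theorem InG3.abs_eigenvector (h : InG3 Γ θ₀ θ₁ θ₂) {z : V → ℝ}
    (hz : Γ.adjMatrix ℝ *ᵥ z = θ₀ • z) : Γ.adjMatrix ℝ *ᵥ |z| = θ₀ • |z| := by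
  have key : ∀ w : V → ℝ, w ⬝ᵥ ((θ₀ • (1 : Matrix V V ℝ) - Γ.adjMatrix ℝ) *ᵥ w) =
      θ₀ * ∑ u, w u * w u - ∑ u, ∑ v, w u * (Γ.adjMatrix ℝ u v * w v) := by
    intro w
    rw [Matrix.sub_mulVec, Matrix.smul_mulVec, Matrix.one_mulVec, dotProduct_sub, dotProduct_smul]
    simp [dotProduct, Matrix.mulVec, Finset.mul_sum]
  have h0 : (θ₀ • (1 : Matrix V V ℝ) - Γ.adjMatrix ℝ) *ᵥ z = 0 := by
    rw [Matrix.sub_mulVec, Matrix.smul_mulVec, Matrix.one_mulVec, hz, sub_self]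
  have h1 : θ₀ * ∑ u, z u * z u - ∑ u, ∑ v, z u * (Γ.adjMatrix ℝ u v * z v) = 0 := by
    rw [← key, h0, dotProduct_zero]
  have h2 := h.posSemidef.dotProduct_mulVec_nonneg |z|
  rw [star_trivial, key] at h2
  have h3 : ∑ u, ∑ v, z u * (Γ.adjMatrix ℝ u v * z v) ≤
      ∑ u, ∑ v, |z| u * (Γ.adjMatrix ℝ u v * |z| v) := by
    refine Finset.sum_le_sum fun u _ => Finset.sum_le_sum fun v _ => ?_
    refine (le_abs_self _).trans (le_of_eq ?_)
    rw [abs_mul, abs_mul, Pi.abs_apply, Pi.abs_apply, SimpleGraph.adjMatrix_apply]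
    split_ifs <;> simp
  have h4 : (θ₀ • (1 : Matrix V V ℝ) - Γ.adjMatrix ℝ) *ᵥ |z| = 0 := by
    rw [← h.posSemidef.dotProduct_mulVec_zero_iff, star_trivial, key]
    simp only [Pi.abs_apply, abs_mul_abs_self] at h2 h3 ⊢
    linarith
  rw [Matrix.sub_mulVec, Matrix.smul_mulVec, Matrix.one_mulVec, sub_eq_zero] at h4
  exact h4.symm

/-- This is the simplicity of `θ₀`. At a zero of `|z|` the values at the neighbours are nonnegative
with sum zero, so zeros spread along walks. -/
theorem InG3.eigenvector_eq_zero (h : InG3 Γ θ₀ θ₁ θ₂) {z : V → ℝ}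
    (hz : Γ.adjMatrix ℝ *ᵥ z = θ₀ • z) {u : V} (hu : z u = 0) : z = 0 := by
  have hs := h.abs_eigenvector hz
  have step : ∀ a b, Γ.Adj a b → z a = 0 → z b = 0 := by
    intro a b hab ha
    have h1 := congrFun hs a
    rw [SimpleGraph.adjMatrix_mulVec_apply] at h1
    simp only [Pi.abs_apply, Pi.smul_apply, ha, abs_zero, smul_zero] at h1
    rw [Finset.sum_eq_zero_iff_of_nonneg fun i _ => abs_nonneg _] at h1
    exact abs_eq_zero.1 (h1 b (by simpa using hab))
  funext v
  obtain ⟨p⟩ := h.connected.preconnected u v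
  induction p with
  | nil => exact hu
  | cons hab _ ih => exact ih (step _ _ hab hu)

/-- `(A - θ₁ I) (A - θ₂ I) = a aᵀ` for a positive vector `a`. -/
theorem InG3.exists_pos (h : InG3 Γ θ₀ θ₁ θ₂) :
    ∃ a : V → ℝ, (∀ u, 0 < a u) ∧ ∀ u v, (Γ.adjMatrix ℝ * Γ.adjMatrix ℝ) u v =
      (θ₁ + θ₂) * Γ.adjMatrix ℝ u v - θ₁ * θ₂ * (1 : Matrix V V ℝ) u v + a u * a v := by
  set A := Γ.adjMatrix ℝ with hAdef
  have hmem : θ₀ ∈ spectrum ℝ A := by rw [h.spectrum_eq]; simp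
  rw [← Matrix.spectrum_toLin', ← Module.End.hasEigenvalue_iff_mem_spectrum] at hmem
  obtain ⟨w, hw⟩ := hmem.exists_hasEigenvector
  have hwA : A *ᵥ w = θ₀ • w := by simpa using hw.apply_eq_smul
  have hw0 : ∀ u, w u ≠ 0 := fun u hu => hw.2 (h.eigenvector_eq_zero hwA hu)
  have hα : A *ᵥ |w| = θ₀ • |w| := h.abs_eigenvector hwA
  have hαpos : ∀ u, 0 < |w| u := fun u => abs_pos.2 (hw0 u)
  generalize |w| = α at hα hαpos
  set N := (A - θ₁ • 1) * (A - θ₂ • 1) with hN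
  have hNsymm : Nᵀ = N := by
    have hAt : Aᵀ = A := Γ.isSymm_adjMatrix
    rw [hN]
    simp only [Matrix.transpose_mul, Matrix.transpose_sub, Matrix.transpose_smul,
      Matrix.transpose_one, hAt]
    simp only [sub_mul, mul_sub, Matrix.smul_mul, Matrix.mul_smul, one_mul, mul_one]
    rw [smul_comm θ₂ θ₁]
    abel
  have hAN : A * N = θ₀ • N := by
    have := h.cubic
    rwa [sub_mul, Matrix.smul_mul, one_mul, sub_eq_zero] at this
  obtain ⟨u₀⟩ := h.connected.nonempty
  -- Subtracting from a column of `N` the multiple of `α` that agrees with it at `u₀` leaves a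
  -- `θ₀`-eigenvector with a zero entry.
  have hcol : ∀ v u, N u v = N u₀ v / α u₀ * α u := by
    intro v u
    have hz : A *ᵥ (N.col v - (N u₀ v / α u₀) • α) = θ₀ • (N.col v - (N u₀ v / α u₀) • α) := by
      rw [Matrix.mulVec_sub, Matrix.mulVec_smul, hα, smul_sub, smul_comm]
      congr 1
      funext t
      exact congrFun (congrFun hAN t) v
    have h0 := h.eigenvector_eq_zero hz (u := u₀) (by
      simp [Matrix.col, (hαpos u₀).ne'])
    have h1 := congrFun h0 u
    simpa [Matrix.col, sub_eq_zero] using h1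
  have hN2 : ∀ u v, N u v = N u₀ u₀ / (α u₀ * α u₀) * (α u * α v) := by
    intro u v
    have h1 : N u₀ v = N v u₀ := congrFun (congrFun hNsymm v) u₀
    rw [hcol v u, h1, hcol u₀ v]
    have := (hαpos u₀).ne'
    field_simp
  set c := N u₀ u₀ / (α u₀ * α u₀) with hc
  have hNα : N *ᵥ α = ((θ₀ - θ₁) * (θ₀ - θ₂)) • α := by
    rw [hN, ← Matrix.mulVec_mulVec]
    simp only [Matrix.sub_mulVec, Matrix.smul_mulVec, Matrix.one_mulVec, hα, Matrix.mulVec_sub,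
      Matrix.mulVec_smul]
    ext t
    simp only [Pi.sub_apply, Pi.smul_apply, smul_eq_mul]
    ring
  -- `N = c α αᵀ` acts on `α` both as `c ‖α‖²` and as `(θ₀ - θ₁)(θ₀ - θ₂) > 0`.
  have hcpos : 0 < c := by
    have h1 := congrFun hNα u₀
    have h2 : (N *ᵥ α) u₀ = c * ((∑ t, α t * α t) * α u₀) := by
      simp only [Matrix.mulVec, dotProduct, hN2, Finset.sum_mul, Finset.mul_sum]
      exact Finset.sum_congr rfl fun t _ => by ring
    rw [h2, Pi.smul_apply, smul_eq_mul, ← mul_assoc] at h1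
    have h3 := mul_right_cancel₀ (hαpos u₀).ne' h1
    have h4 : 0 < (θ₀ - θ₁) * (θ₀ - θ₂) := by
      have := h.lt₀₁
      have := h.lt₁₂
      exact mul_pos (by linarith) (by linarith)
    have h5 : 0 ≤ ∑ t, α t * α t := Finset.sum_nonneg fun t _ => mul_self_nonneg _
    rw [← h3] at h4
    exact pos_of_mul_pos_left h4 h5
  refine ⟨fun u => √c * α u, fun u => mul_pos (Real.sqrt_pos.2 hcpos) (hαpos u), fun u v => ?_⟩
  have h1 : N u v = (A * A) u v - (θ₁ + θ₂) * A u v + θ₁ * θ₂ * (1 : Matrix V V ℝ) u v := by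
    rw [hN]
    simp only [sub_mul, mul_sub, Matrix.smul_mul, Matrix.mul_smul, one_mul, mul_one,
      Matrix.sub_apply, Matrix.smul_apply, smul_eq_mul]
    ring
  have h2 : √c * α u * (√c * α v) = N u v := by
    rw [hN2]
    linear_combination (α u * α v) * Real.mul_self_sqrt hcpos.le
  rw [h2, h1]
  ring

end Perron

/-! ### Colours and fibres of the configuration of an algebra -/

namespace CoherentConfiguration

variable {V : Type*} [Fintype V] [DecidableEq V] {C : CoherentConfiguration V}

theorem existsUnique_mem (C : CoherentConfiguration V) (p : V × V) : ∃! R, R ∈ C.rels ∧ p ∈ R := by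
  have h := congrFun (congrFun C.sum_eq_ones p.1) p.2
  simp only [Matrix.sum_apply, relMatrix_apply, Matrix.of_apply, Finset.sum_boole] at h
  have h1 : (C.rels.filter fun R => p ∈ R).card = 1 := by exact_mod_cast h
  obtain ⟨R, hR⟩ := Finset.card_eq_one.1 h1
  have h2 : ∀ T, (T ∈ C.rels ∧ p ∈ T) ↔ T = R := fun T => by
    rw [← Finset.mem_singleton, ← hR, Finset.mem_filter]
  exact ⟨R, (h2 R).2 rfl, fun T hT => (h2 T).1 hT⟩

/-- The relation containing the pair `(u, w)`. -/
noncomputable def colour (C : CoherentConfiguration V) (u w : V) : Finset (V × V) :=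
  (C.existsUnique_mem (u, w)).choose

theorem colour_mem (C : CoherentConfiguration V) (u w : V) : C.colour u w ∈ C.rels :=
  (C.existsUnique_mem (u, w)).choose_spec.1.1

theorem mem_colour (C : CoherentConfiguration V) (u w : V) : (u, w) ∈ C.colour u w :=
  (C.existsUnique_mem (u, w)).choose_spec.1.2

theorem eq_colour {R : Finset (V × V)} (hR : R ∈ C.rels) {u w : V} (h : (u, w) ∈ R) :
    R = C.colour u w :=
  (C.existsUnique_mem (u, w)).unique ⟨hR, h⟩ ⟨C.colour_mem u w, C.mem_colour u w⟩

theorem mem_colour_iff {u w a b : V} : (a, b) ∈ C.colour u w ↔ C.colour a b = C.colour u w :=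
  ⟨fun h => (eq_colour (C.colour_mem u w) h).symm, fun h => h ▸ C.mem_colour a b⟩

variable {S : Subalgebra ℂ (Matrix V V ℂ)}

theorem IsConfigurationOf.relMatrix_mem (hC : C.IsConfigurationOf S) {R : Finset (V × V)}
    (hR : R ∈ C.rels) : relMatrix R ∈ S := by
  have : relMatrix R ∈ Subalgebra.toSubmodule S := by
    rw [← hC.span_eq]
    exact Submodule.subset_span ⟨⟨R, hR⟩, rfl⟩
  exact this

/-- Relation matrices span the algebra and each is a function of the colour. All later constancy
statements come from choosing a suitable `X`. -/
theorem IsConfigurationOf.apply_eq (hC : C.IsConfigurationOf S) {X : Matrix V V ℂ} (hX : X ∈ S)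
    {u w u' w' : V} (h : C.colour u w = C.colour u' w') : X u w = X u' w' := by
  have hX' : X ∈ Subalgebra.toSubmodule S := hX
  rw [← hC.span_eq] at hX'
  induction hX' using Submodule.span_induction with
  | mem X hX' =>
    obtain ⟨R, rfl⟩ := hX'
    have h1 : ∀ a b, (a, b) ∈ R.1 ↔ R.1 = C.colour a b := fun a b =>
      ⟨fun h => eq_colour R.2 h, fun h => h ▸ C.mem_colour a b⟩
    simp only [relMatrix_apply, h1, h]
  | zero => rfl
  | add X Y hX' hY' h1 h2 =>
    rw [hC.span_eq] at hX' hY'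
    rw [Matrix.add_apply, Matrix.add_apply, h1 hX', h2 hY']
  | smul a X hX' h1 =>
    rw [hC.span_eq] at hX'
    rw [Matrix.smul_apply, Matrix.smul_apply, h1 hX']

theorem IsConfigurationOf.eq_of_colour_diag (hC : C.IsConfigurationOf S) {u a b : V}
    (h : C.colour a b = C.colour u u) : a = b := by
  have h1 := hC.apply_eq S.one_mem h
  by_contra hne
  simp [hne] at h1

theorem IsConfigurationOf.exists_fibre (hC : C.IsConfigurationOf S) (u : V) :
    ∃ F ∈ C.fibres, u ∈ F := by
  refine ⟨Finset.univ.filter fun w => (w, w) ∈ C.colour u u,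
    ⟨C.colour u u, C.colour_mem u u, ?_, by simp⟩, by simp [C.mem_colour]⟩
  rintro ⟨a, b⟩ h
  exact hC.eq_of_colour_diag (mem_colour_iff.1 h)

theorem mem_fibre_iff {F : Finset V} (hF : F ∈ C.fibres) {u : V} (hu : u ∈ F) (w : V) :
    w ∈ F ↔ C.colour w w = C.colour u u := by
  obtain ⟨R, hR, -, h⟩ := hF
  rw [h w, eq_colour hR ((h u).1 hu), mem_colour_iff]

theorem fibre_nonempty {F : Finset V} (hF : F ∈ C.fibres) : F.Nonempty := by
  obtain ⟨R, hR, hd, h⟩ := hF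
  obtain ⟨⟨a, b⟩, hp⟩ := C.nonempty_of_mem R hR
  have : a = b := hd _ hp
  subst this
  exact ⟨a, (h a).2 hp⟩

theorem fibre_eq {F G : Finset V} (hF : F ∈ C.fibres) (hG : G ∈ C.fibres) {u : V} (hu : u ∈ F)
    (hu' : u ∈ G) : F = G := by
  ext w
  rw [mem_fibre_iff hF hu, mem_fibre_iff hG hu']

theorem IsConfigurationOf.diagonal_mem (hC : C.IsConfigurationOf S) {F : Finset V}
    (hF : F ∈ C.fibres) :
    (Matrix.diagonal fun u => if u ∈ F then (1 : ℂ) else 0) ∈ S := by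
  obtain ⟨R, hR, hd, h⟩ := hF
  convert hC.relMatrix_mem hR using 1
  ext u w
  rw [relMatrix_apply, Matrix.diagonal_apply]
  by_cases huw : u = w
  · subst huw
    simp [h]
  · rw [if_neg huw, if_neg fun h => huw (hd _ h)]

/-- The products of `J` with the diagonal idempotent of `F`, on either side, lie in `S` and record
whether the first or the second endpoint is in `F`. Hence a relation meeting `F × G` is contained in
it, and type entries count colours. -/
theorem IsConfigurationOf.mem_fibre_congr (hC : C.IsConfigurationOf S) (hS : IsCoherentAlgebra S)
    {F : Finset V} (hF : F ∈ C.fibres) {u w u' w' : V} (h : C.colour u w = C.colour u' w') :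
    (u ∈ F ↔ u' ∈ F) ∧ (w ∈ F ↔ w' ∈ F) := by
  have h1 := hC.apply_eq (S.mul_mem (hC.diagonal_mem hF) hS.ones_mem) h
  have h2 := hC.apply_eq (S.mul_mem hS.ones_mem (hC.diagonal_mem hF)) h
  simp only [Matrix.diagonal_mul, Matrix.mul_diagonal, Matrix.of_apply, mul_one, one_mul] at h1 h2
  constructor
  · by_cases ha : u ∈ F <;> by_cases hb : u' ∈ F <;> simp_all
  · by_cases ha : w ∈ F <;> by_cases hb : w' ∈ F <;> simp_all

theorem IsConfigurationOf.typeEntry_eq (hC : C.IsConfigurationOf S) (hS : IsCoherentAlgebra S)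
    {F G : Finset V} (hF : F ∈ C.fibres) (hG : G ∈ C.fibres) :
    C.typeEntry F G = ((F ×ˢ G).image fun p => C.colour p.1 p.2).card := by
  rw [typeEntry]
  congr 1
  ext R
  rw [Finset.mem_filter, Finset.mem_image]
  constructor
  · rintro ⟨hR, hsub⟩
    obtain ⟨p, hp⟩ := C.nonempty_of_mem R hR
    exact ⟨p, hsub hp, (eq_colour hR hp).symm⟩
  · rintro ⟨⟨u, w⟩, hp, rfl⟩
    refine ⟨C.colour_mem u w, ?_⟩
    rintro ⟨a, b⟩ hab
    have h := mem_colour_iff.1 hab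
    rw [Finset.mem_product] at hp ⊢
    exact ⟨(hC.mem_fibre_congr hS hF h).1.2 hp.1, (hC.mem_fibre_congr hS hG h).2.2 hp.2⟩

/-- Row sums over a fibre are constant on fibres. -/
theorem IsConfigurationOf.row_sum_eq (hC : C.IsConfigurationOf S) (hS : IsCoherentAlgebra S)
    {F G : Finset V} (hF : F ∈ C.fibres) (hG : G ∈ C.fibres) {X : Matrix V V ℂ} (hX : X ∈ S)
    {u u' : V} (hu : u ∈ F) (hu' : u' ∈ F) : ∑ z ∈ G, X u z = ∑ z ∈ G, X u' z := by
  have h := hC.apply_eq (S.mul_mem (S.mul_mem hX (hC.diagonal_mem hG)) hS.ones_mem)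
    ((mem_fibre_iff hF hu' u).1 hu)
  rw [Matrix.mul_apply, Matrix.mul_apply] at h
  simpa [Matrix.mul_diagonal, Finset.sum_ite_mem] using h

theorem IsConfigurationOf.col_sum_eq (hC : C.IsConfigurationOf S) (hS : IsCoherentAlgebra S)
    {F G : Finset V} (hF : F ∈ C.fibres) (hG : G ∈ C.fibres) {X : Matrix V V ℂ} (hX : X ∈ S)
    {u u' : V} (hu : u ∈ F) (hu' : u' ∈ F) : ∑ z ∈ G, X z u = ∑ z ∈ G, X z u' :=
  hC.row_sum_eq hS hF hG (hS.transpose_mem X hX) hu hu'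

theorem IsConfigurationOf.partial_mul_eq (hC : C.IsConfigurationOf S)
    {G : Finset V} (hG : G ∈ C.fibres) {X Y : Matrix V V ℂ} (hX : X ∈ S) (hY : Y ∈ S)
    {u w u' w' : V} (h : C.colour u w = C.colour u' w') :
    ∑ z ∈ G, X u z * Y z w = ∑ z ∈ G, X u' z * Y z w' := by
  have h := hC.apply_eq (S.mul_mem (S.mul_mem hX (hC.diagonal_mem hG)) hY) h
  rw [Matrix.mul_apply, Matrix.mul_apply] at h
  simpa [Matrix.mul_diagonal, Finset.sum_ite_mem] using h

end CoherentConfiguration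

/-! ### Neighbour counts as entry sums -/

theorem adjMatrix_mem_coherentClosure {V : Type*} [Fintype V] [DecidableEq V] (Γ : SimpleGraph V)
    [DecidableRel Γ.Adj] : Γ.adjMatrix ℂ ∈ coherentClosure Γ :=
  (coherentClosure_isLeast Γ).1.2

theorem isCoherentAlgebra_coherentClosure {V : Type*} [Fintype V] [DecidableEq V]
    (Γ : SimpleGraph V) [DecidableRel Γ.Adj] : IsCoherentAlgebra (coherentClosure Γ) :=
  (coherentClosure_isLeast Γ).1.1

theorem SimpleGraph.sum_adjMatrix_mul_adjMatrix {V R : Type*} [Fintype V] [DecidableEq V]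
    [CommSemiring R] (Γ : SimpleGraph V) [DecidableRel Γ.Adj] (G : Finset V) (u w : V) :
    ∑ z ∈ G, Γ.adjMatrix R u z * Γ.adjMatrix R z w =
      ((Γ.neighborFinset u ∩ Γ.neighborFinset w ∩ G).card : R) := by
  have : ∀ z, Γ.adjMatrix R u z * Γ.adjMatrix R z w =
      if z ∈ Γ.neighborFinset u ∩ Γ.neighborFinset w then 1 else 0 := by
    intro z
    simp only [SimpleGraph.adjMatrix_apply, Finset.mem_inter, SimpleGraph.mem_neighborFinset,
      Γ.adj_comm z w]
    split_ifs <;> simp_all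
  simp only [this, Finset.sum_boole]
  congr 2
  ext z
  simp only [Finset.mem_filter, Finset.mem_inter]
  tauto

theorem SimpleGraph.sum_adjMatrix {V R : Type*} [Fintype V] [DecidableEq V]
    [CommSemiring R] (Γ : SimpleGraph V) [DecidableRel Γ.Adj] (G : Finset V) (u : V) :
    ∑ z ∈ G, Γ.adjMatrix R u z = ((Γ.neighborFinset u ∩ G).card : R) := by
  simp only [SimpleGraph.adjMatrix_apply, Finset.sum_boole]
  congr 2
  ext z
  simp [and_comm]

theorem sum_eq_sum_add_sum_of_cover {V R : Type*} [Fintype V] [DecidableEq V] [AddCommMonoid R]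
    {P Q : Finset V} (hd : Disjoint P Q) (hcov : ∀ u, u ∈ P ∨ u ∈ Q) (f : V → R) :
    ∑ z, f z = ∑ z ∈ P, f z + ∑ z ∈ Q, f z := by
  rw [← Finset.sum_union hd]
  congr 1
  ext u
  simpa using hcov u

/-! ### Minimality of the closure: adjacency separates the relations -/

/-- The block `P × Q` of `X` is constant. -/
def ConstOn {V : Type*} (X : Matrix V V ℂ) (P Q : Finset V) : Prop :=
  ∀ u ∈ P, ∀ u' ∈ P, ∀ w ∈ Q, ∀ w' ∈ Q, X u w = X u' w'

/-- The off-diagonal entries of the block `Q × Q` of `X` are constant. -/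
def OffDiagConstOn {V : Type*} (X : Matrix V V ℂ) (Q : Finset V) : Prop :=
  ∀ u ∈ Q, ∀ w ∈ Q, ∀ u' ∈ Q, ∀ w' ∈ Q, u ≠ w → u' ≠ w' → X u w = X u' w'

namespace CoherentConfiguration

variable {V : Type*} [Fintype V] [DecidableEq V] {C : CoherentConfiguration V}
  {S : Subalgebra ℂ (Matrix V V ℂ)} {P Q : Finset V}

/-- Split the middle index between `P` and `Q`. In each part one factor is constant and comes out,
leaving a row or column sum within a fibre, which does not depend on the vertex. -/
theorem IsConfigurationOf.constOn_mul (hC : C.IsConfigurationOf S) (hS : IsCoherentAlgebra S)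
    (hP : P ∈ C.fibres) (hQ : Q ∈ C.fibres) (hd : Disjoint P Q) (hcov : ∀ u, u ∈ P ∨ u ∈ Q)
    {X Y : Matrix V V ℂ} (hX : X ∈ S) (hY : Y ∈ S) (hXc : ConstOn X P Q) (hYc : ConstOn Y P Q) :
    ConstOn (X * Y) P Q := by
  intro u hu u' hu' w hw w' hw'
  rw [Matrix.mul_apply, Matrix.mul_apply, sum_eq_sum_add_sum_of_cover hd hcov,
    sum_eq_sum_add_sum_of_cover hd hcov]
  have h1 : ∀ u ∈ P, ∀ w ∈ Q, ∑ z ∈ P, X u z * Y z w = (∑ z ∈ P, X u z) * Y u w := by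
    intro u hu w hw
    rw [Finset.sum_mul]
    exact Finset.sum_congr rfl fun z hz => by rw [hYc z hz u hu w hw w hw]
  have h2 : ∀ u ∈ P, ∀ w ∈ Q, ∑ z ∈ Q, X u z * Y z w = X u w * ∑ z ∈ Q, Y z w := by
    intro u hu w hw
    rw [Finset.mul_sum]
    exact Finset.sum_congr rfl fun z hz => by rw [hXc u hu u hu z hz w hw]
  rw [h1 u hu w hw, h1 u' hu' w' hw', h2 u hu w hw, h2 u' hu' w' hw',
    hXc u hu u' hu' w hw w' hw', hYc u hu u' hu' w hw w' hw',
    hC.row_sum_eq hS hP hP hX hu hu', hC.col_sum_eq hS hQ hQ hY hw hw']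

/-- The matrices in `S` whose off-diagonal blocks are constant. -/
def constBlockSubalgebra (hC : C.IsConfigurationOf S) (hS : IsCoherentAlgebra S)
    (hP : P ∈ C.fibres) (hQ : Q ∈ C.fibres) (hd : Disjoint P Q) (hcov : ∀ u, u ∈ P ∨ u ∈ Q) :
    Subalgebra ℂ (Matrix V V ℂ) where
  carrier := {X | X ∈ S ∧ ConstOn X P Q ∧ ConstOn X Q P}
  mul_mem' := by
    rintro X Y ⟨hX, h1, h2⟩ ⟨hY, h3, h4⟩
    exact ⟨S.mul_mem hX hY, hC.constOn_mul hS hP hQ hd hcov hX hY h1 h3,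
      hC.constOn_mul hS hQ hP hd.symm (fun u => (hcov u).symm) hX hY h2 h4⟩
  add_mem' := by
    rintro X Y ⟨hX, h1, h2⟩ ⟨hY, h3, h4⟩
    refine ⟨S.add_mem hX hY, ?_, ?_⟩
    · intro u hu u' hu' w hw w' hw'
      rw [Matrix.add_apply, Matrix.add_apply, h1 u hu u' hu' w hw w' hw',
        h3 u hu u' hu' w hw w' hw']
    · intro u hu u' hu' w hw w' hw'
      rw [Matrix.add_apply, Matrix.add_apply, h2 u hu u' hu' w hw w' hw',
        h4 u hu u' hu' w hw w' hw']
  algebraMap_mem' := by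
    intro c
    have h : ∀ u ∈ P, ∀ w ∈ Q, u ≠ w := fun u hu w hw e =>
      Finset.disjoint_left.1 hd hu (e ▸ hw)
    refine ⟨S.algebraMap_mem c, ?_, ?_⟩
    · intro u hu u' hu' w hw w' hw'
      simp [Matrix.algebraMap_matrix_apply, h u hu w hw, h u' hu' w' hw']
    · intro u hu u' hu' w hw w' hw'
      simp [Matrix.algebraMap_matrix_apply, (h w hw u hu).symm, (h w' hw' u' hu').symm]

theorem IsConfigurationOf.isCoherentAlgebra_constBlockSubalgebra (hC : C.IsConfigurationOf S)
    (hS : IsCoherentAlgebra S) (hP : P ∈ C.fibres) (hQ : Q ∈ C.fibres) (hd : Disjoint P Q)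
    (hcov : ∀ u, u ∈ P ∨ u ∈ Q) :
    IsCoherentAlgebra (constBlockSubalgebra hC hS hP hQ hd hcov) where
  ones_mem := ⟨hS.ones_mem, fun _ _ _ _ _ _ _ _ => rfl, fun _ _ _ _ _ _ _ _ => rfl⟩
  transpose_mem := fun X hX => ⟨hS.transpose_mem X hX.1,
    fun u hu u' hu' w hw w' hw' => hX.2.2 w hw w' hw' u hu u' hu',
    fun u hu u' hu' w hw w' hw' => hX.2.1 w hw w' hw' u hu u' hu'⟩
  hadamard_mem := fun X hX Y hY => ⟨hS.hadamard_mem X hX.1 Y hY.1,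
    fun u hu u' hu' w hw w' hw' => by
      rw [Matrix.hadamard_apply, Matrix.hadamard_apply, hX.2.1 u hu u' hu' w hw w' hw',
        hY.2.1 u hu u' hu' w hw w' hw'],
    fun u hu u' hu' w hw w' hw' => by
      rw [Matrix.hadamard_apply, Matrix.hadamard_apply, hX.2.2 u hu u' hu' w hw w' hw',
        hY.2.2 u hu u' hu' w hw w' hw']⟩

variable {Γ : SimpleGraph V} [DecidableRel Γ.Adj]

/-- If there are two relations between the two fibres, then they are distinguished by adjacency. -/
theorem IsConfigurationOf.exists_adj_not_adj (hC : C.IsConfigurationOf (coherentClosure Γ))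
    (hP : P ∈ C.fibres) (hQ : Q ∈ C.fibres) (hd : Disjoint P Q) (hcov : ∀ u, u ∈ P ∨ u ∈ Q)
    (h2 : C.typeEntry P Q = 2) :
    (∃ u ∈ P, ∃ w ∈ Q, Γ.Adj u w) ∧ ∃ u ∈ P, ∃ w ∈ Q, ¬ Γ.Adj u w := by
  have hS := isCoherentAlgebra_coherentClosure Γ
  by_contra hcon
  have hcon' : ∀ u ∈ P, ∀ w ∈ Q, ∀ u' ∈ P, ∀ w' ∈ Q, (Γ.Adj u w ↔ Γ.Adj u' w') := by
    intro u hu w hw u' hu' w' hw'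
    by_contra h
    apply hcon
    by_cases h1 : Γ.Adj u w
    · exact ⟨⟨u, hu, w, hw, h1⟩, ⟨u', hu', w', hw', by tauto⟩⟩
    · exact ⟨⟨u', hu', w', hw', by tauto⟩, ⟨u, hu, w, hw, h1⟩⟩
  -- By minimality every matrix of the closure is then constant on `P × Q`, but the matrix of one of
  -- the two relations there is not.
  have hle : coherentClosure Γ ≤ constBlockSubalgebra hC hS hP hQ hd hcov := by
    refine (coherentClosure_isLeast Γ).2
      ⟨hC.isCoherentAlgebra_constBlockSubalgebra hS hP hQ hd hcov,
        adjMatrix_mem_coherentClosure Γ, ?_, ?_⟩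
    · intro u hu u' hu' w hw w' hw'
      simp only [SimpleGraph.adjMatrix_apply, hcon' u hu w hw u' hu' w' hw']
    · intro u hu u' hu' w hw w' hw'
      simp only [SimpleGraph.adjMatrix_apply, Γ.adj_comm u, Γ.adj_comm u',
        hcon' w hw u hu w' hw' u' hu']
  rw [hC.typeEntry_eq hS hP hQ] at h2
  obtain ⟨R, hR, R', hR', hne⟩ := Finset.one_lt_card.1 (by rw [h2]; norm_num)
  obtain ⟨⟨u, w⟩, hp, rfl⟩ := Finset.mem_image.1 hR
  obtain ⟨⟨u', w'⟩, hp', rfl⟩ := Finset.mem_image.1 hR'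
  rw [Finset.mem_product] at hp hp'
  have := (hle (hC.relMatrix_mem (C.colour_mem u w))).2.1 u hp.1 u' hp'.1 w hp.2 w' hp'.2
  simp [relMatrix_apply, C.mem_colour, mem_colour_iff, Ne.symm hne] at this

/-- Between the two fibres, the relations are determined by adjacency. -/
theorem IsConfigurationOf.colour_eq_of_adj_iff (hC : C.IsConfigurationOf (coherentClosure Γ))
    (hP : P ∈ C.fibres) (hQ : Q ∈ C.fibres) (hd : Disjoint P Q) (hcov : ∀ u, u ∈ P ∨ u ∈ Q)
    (h2 : C.typeEntry P Q = 2) {u w u' w' : V} (hu : u ∈ P) (hw : w ∈ Q) (hu' : u' ∈ P)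
    (hw' : w' ∈ Q) (h : Γ.Adj u w ↔ Γ.Adj u' w') : C.colour u w = C.colour u' w' := by
  have hS := isCoherentAlgebra_coherentClosure Γ
  obtain ⟨⟨a, ha, b, hb, hab⟩, c, hc, d, hd', hcd⟩ := hC.exists_adj_not_adj hP hQ hd hcov h2
  have hdist : ∀ {a b c d}, Γ.Adj a b → ¬ Γ.Adj c d → C.colour a b ≠ C.colour c d := by
    intro a b c d hab hcd h
    have := hC.apply_eq (adjMatrix_mem_coherentClosure Γ) h
    simp [hab, hcd] at this
  rw [hC.typeEntry_eq hS hP hQ] at h2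
  have hmem : ∀ {a b}, a ∈ P → b ∈ Q →
      C.colour a b ∈ (P ×ˢ Q).image fun p => C.colour p.1 p.2 := fun {a b} ha hb =>
    Finset.mem_image.2 ⟨(a, b), Finset.mem_product.2 ⟨ha, hb⟩, rfl⟩
  by_contra hne
  -- If the two colours differed, a pair with the opposite adjacency would supply a third colour.
  have hcard : ∀ R, R ∈ ((P ×ˢ Q).image fun p => C.colour p.1 p.2) →
      R ≠ C.colour u w → R ≠ C.colour u' w' → False := by
    intro R hR h1 h3
    have : 2 < ((P ×ˢ Q).image fun p => C.colour p.1 p.2).card :=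
      Finset.two_lt_card.2 ⟨_, hR, _, hmem hu hw, _, hmem hu' hw', h1, h3, hne⟩
    omega
  by_cases h1 : Γ.Adj u w
  · exact hcard _ (hmem hc hd') (hdist h1 hcd).symm (hdist (h.1 h1) hcd).symm
  · exact hcard _ (hmem ha hb) (hdist hab h1) (hdist hab fun h3 => h1 (h.2 h3))

/-- If a fibre has only one non-diagonal relation, it is the off-diagonal. -/
theorem IsConfigurationOf.colour_eq_of_typeEntry_eq_two (hC : C.IsConfigurationOf S)
    (hS : IsCoherentAlgebra S) (hP : P ∈ C.fibres) (h2 : C.typeEntry P P = 2) {u w u' w' : V}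
    (hu : u ∈ P) (hw : w ∈ P) (hu' : u' ∈ P) (hw' : w' ∈ P) (hne : u ≠ w) (hne' : u' ≠ w') :
    C.colour u w = C.colour u' w' := by
  rw [hC.typeEntry_eq hS hP hP] at h2
  have hmem : ∀ {a b}, a ∈ P → b ∈ P →
      C.colour a b ∈ (P ×ˢ P).image fun p => C.colour p.1 p.2 := fun {a b} ha hb =>
    Finset.mem_image.2 ⟨(a, b), Finset.mem_product.2 ⟨ha, hb⟩, rfl⟩
  by_contra h
  have : 2 < ((P ×ˢ P).image fun p => C.colour p.1 p.2).card :=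
    Finset.two_lt_card.2 ⟨_, hmem hu hw, _, hmem hu' hw', _, hmem hu hu, h,
      fun h => hne (hC.eq_of_colour_diag h), fun h => hne' (hC.eq_of_colour_diag h)⟩
  omega

theorem IsConfigurationOf.exists_ne_of_typeEntry (hC : C.IsConfigurationOf S)
    (hS : IsCoherentAlgebra S) (hP : P ∈ C.fibres) (h2 : 1 < C.typeEntry P P) :
    ∃ u ∈ P, ∃ w ∈ P, u ≠ w := by
  rw [hC.typeEntry_eq hS hP hP] at h2
  obtain ⟨R, hR, R', hR', hne⟩ := Finset.one_lt_card.1 h2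
  obtain ⟨⟨u, w⟩, hp, rfl⟩ := Finset.mem_image.1 hR
  obtain ⟨⟨u', w'⟩, hp', rfl⟩ := Finset.mem_image.1 hR'
  rw [Finset.mem_product] at hp hp'
  by_contra! h
  have h1 := h u hp.1 w hp.2
  have h3 := h u' hp'.1 w' hp'.2
  simp only at h1 h3 hne
  subst h1 h3
  exact hne ((mem_fibre_iff hP hp'.1 u).1 hp.1)

end CoherentConfiguration

theorem sum_mul_of_offDiag {V R : Type*} [DecidableEq V] [CommRing R] {Q : Finset V}
    {f g : V → R} {c d c' d' : R} {u w : V} (hu : u ∈ Q) (hw : w ∈ Q) (hne : u ≠ w)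
    (hf : ∀ z ∈ Q, f z = if z = u then d else c) (hg : ∀ z ∈ Q, g z = if z = w then d' else c') :
    ∑ z ∈ Q, f z * g z = Q.card * (c * c') + (d - c) * c' + (d' - c') * c := by
  have : ∀ z ∈ Q, f z * g z =
      c * c' + (if z = u then (d - c) * c' else 0) + (if z = w then (d' - c') * c else 0) := by
    intro z hz
    rw [hf z hz, hg z hz]
    split_ifs with h1 h2
    · exact absurd (h1.symm.trans h2) hne
    all_goals ring
  rw [Finset.sum_congr rfl this, Finset.sum_add_distrib, Finset.sum_add_distrib,
    Finset.sum_ite_eq' Q u, Finset.sum_ite_eq' Q w, if_pos hu, if_pos hw, Finset.sum_const,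
    nsmul_eq_mul]

namespace CoherentConfiguration

variable {V : Type*} [Fintype V] [DecidableEq V] {C : CoherentConfiguration V}
  {S : Subalgebra ℂ (Matrix V V ℂ)} {P Q : Finset V}

theorem IsConfigurationOf.sum_mul_offDiag (hC : C.IsConfigurationOf S)
    (hQ : Q ∈ C.fibres) {X Y : Matrix V V ℂ} (hX : X ∈ S) (hY : Y ∈ S)
    (hXc : OffDiagConstOn X Q) (hYc : OffDiagConstOn Y Q) {u w u' w' : V} (hu : u ∈ Q)
    (hw : w ∈ Q) (hu' : u' ∈ Q) (hw' : w' ∈ Q) (hne : u ≠ w) (hne' : u' ≠ w') :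
    ∑ z ∈ Q, X u z * Y z w = ∑ z ∈ Q, X u' z * Y z w' := by
  have hrow : ∀ a ∈ Q, ∀ z ∈ Q, X a z = if z = a then X u u else X u w := by
    intro a ha z hz
    split_ifs with h
    · subst h
      exact hC.apply_eq hX ((mem_fibre_iff hQ hu z).1 hz)
    · exact hXc a ha z hz u hu w hw (Ne.symm h) hne
  have hcol : ∀ a ∈ Q, ∀ z ∈ Q, Y z a = if z = a then Y u u else Y u w := by
    intro a ha z hz
    split_ifs with h
    · subst h
      exact hC.apply_eq hY ((mem_fibre_iff hQ hu z).1 hz)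
    · exact hYc z hz a ha u hu w hw h hne
  rw [sum_mul_of_offDiag hu hw hne (hrow u hu) (hcol w hw),
    sum_mul_of_offDiag hu' hw' hne' (hrow u' hu') (hcol w' hw')]

/-- The matrices in `S` whose block on the fibre `Q` is a combination of `I` and `J`. -/
def offDiagConstSubalgebra (S : Subalgebra ℂ (Matrix V V ℂ)) (Q : Finset V)
    (hmul : ∀ X ∈ S, ∀ Y ∈ S, OffDiagConstOn X Q → OffDiagConstOn Y Q →
      OffDiagConstOn (X * Y) Q) : Subalgebra ℂ (Matrix V V ℂ) where
  carrier := {X | X ∈ S ∧ OffDiagConstOn X Q}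
  mul_mem' := fun {X Y} hX hY => ⟨S.mul_mem hX.1 hY.1, hmul X hX.1 Y hY.1 hX.2 hY.2⟩
  add_mem' := fun {X Y} hX hY => ⟨S.add_mem hX.1 hY.1, fun u hu w hw u' hu' w' hw' h h' => by
    rw [Matrix.add_apply, Matrix.add_apply, hX.2 u hu w hw u' hu' w' hw' h h',
      hY.2 u hu w hw u' hu' w' hw' h h']⟩
  algebraMap_mem' := fun c => ⟨S.algebraMap_mem c, fun u hu w hw u' hu' w' hw' h h' => by
    simp [Matrix.algebraMap_matrix_apply, h, h']⟩

theorem isCoherentAlgebra_offDiagConstSubalgebra (hS : IsCoherentAlgebra S)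
    (hmul : ∀ X ∈ S, ∀ Y ∈ S, OffDiagConstOn X Q → OffDiagConstOn Y Q →
      OffDiagConstOn (X * Y) Q) : IsCoherentAlgebra (offDiagConstSubalgebra S Q hmul) where
  ones_mem := ⟨hS.ones_mem, fun _ _ _ _ _ _ _ _ _ _ => rfl⟩
  transpose_mem := fun X hX => ⟨hS.transpose_mem X hX.1, fun u hu w hw u' hu' w' hw' h h' =>
    hX.2 w hw u hu w' hw' u' hu' h.symm h'.symm⟩
  hadamard_mem := fun X hX Y hY => ⟨hS.hadamard_mem X hX.1 Y hY.1,
    fun u hu w hw u' hu' w' hw' h h' => by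
      rw [Matrix.hadamard_apply, Matrix.hadamard_apply, hX.2 u hu w hw u' hu' w' hw' h h',
        hY.2 u hu w hw u' hu' w' hw' h h']⟩

variable {Γ : SimpleGraph V} [DecidableRel Γ.Adj]

/-- Adjacency determines the colour between the fibres, so any two values on that block are
interpolated by a polynomial of degree one in the adjacency entry. -/
theorem IsConfigurationOf.exists_affine (hC : C.IsConfigurationOf (coherentClosure Γ))
    (hP : P ∈ C.fibres) (hQ : Q ∈ C.fibres) (hd : Disjoint P Q) (hcov : ∀ u, u ∈ P ∨ u ∈ Q)
    (h2 : C.typeEntry P Q = 2) {X : Matrix V V ℂ} (hX : X ∈ coherentClosure Γ) :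
    ∃ p q : ℂ, ∀ u ∈ P, ∀ w ∈ Q, X u w = p + q * Γ.adjMatrix ℂ u w := by
  obtain ⟨⟨a, ha, b, hb, hab⟩, c, hc, d, hd', hcd⟩ := hC.exists_adj_not_adj hP hQ hd hcov h2
  refine ⟨X c d, X a b - X c d, fun u hu w hw => ?_⟩
  by_cases h : Γ.Adj u w
  · rw [hC.apply_eq hX (hC.colour_eq_of_adj_iff hP hQ hd hcov h2 hu hw ha hb (by tauto))]
    simp [h]
  · rw [hC.apply_eq hX (hC.colour_eq_of_adj_iff hP hQ hd hcov h2 hu hw hc hd' (by tauto))]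
    simp [h]

/-- If there are three relations on the fibre `Q`, then adjacency distinguishes the two
non-diagonal ones. -/
theorem IsConfigurationOf.exists_adj_not_adj_of_three
    (hC : C.IsConfigurationOf (coherentClosure Γ))
    (hP : P ∈ C.fibres) (hQ : Q ∈ C.fibres) (hd : Disjoint P Q) (hcov : ∀ u, u ∈ P ∨ u ∈ Q)
    (h2 : C.typeEntry P Q = 2) (h3 : C.typeEntry Q Q = 3)
    (hA : OffDiagConstOn (Γ.adjMatrix ℂ) Q →
      OffDiagConstOn (Γ.adjMatrix ℂ * Γ.adjMatrix ℂ) Q) :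
    (∃ u ∈ Q, ∃ w ∈ Q, Γ.Adj u w) ∧ ∃ u ∈ Q, ∃ w ∈ Q, u ≠ w ∧ ¬ Γ.Adj u w := by
  have hS := isCoherentAlgebra_coherentClosure Γ
  have hAS := adjMatrix_mem_coherentClosure Γ
  by_contra hcon
  have hAQ : OffDiagConstOn (Γ.adjMatrix ℂ) Q := by
    intro u hu w hw u' hu' w' hw' hne hne'
    have : Γ.Adj u w ↔ Γ.Adj u' w' := by
      by_contra h
      apply hcon
      by_cases h1 : Γ.Adj u w
      · exact ⟨⟨u, hu, w, hw, h1⟩, ⟨u', hu', w', hw', hne', by tauto⟩⟩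
      · exact ⟨⟨u', hu', w', hw', by tauto⟩, ⟨u, hu, w, hw, hne, h1⟩⟩
    simp only [SimpleGraph.adjMatrix_apply, this]
  -- The number of common neighbours in `P` is an entry of `A²` minus the part of the sum over `Q`;
  -- both are constant off the diagonal.
  have hAP : ∀ u ∈ Q, ∀ w ∈ Q, ∀ u' ∈ Q, ∀ w' ∈ Q, u ≠ w → u' ≠ w' →
      ∑ z ∈ P, Γ.adjMatrix ℂ u z * Γ.adjMatrix ℂ z w =
        ∑ z ∈ P, Γ.adjMatrix ℂ u' z * Γ.adjMatrix ℂ z w' := by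
    intro u hu w hw u' hu' w' hw' hne hne'
    have h := hA hAQ u hu w hw u' hu' w' hw' hne hne'
    rw [Matrix.mul_apply, Matrix.mul_apply, sum_eq_sum_add_sum_of_cover hd hcov,
      sum_eq_sum_add_sum_of_cover hd hcov,
      hC.sum_mul_offDiag hQ hAS hAS hAQ hAQ hu hw hu' hw' hne hne'] at h
    exact add_right_cancel h
  have hmul : ∀ X ∈ coherentClosure Γ, ∀ Y ∈ coherentClosure Γ, OffDiagConstOn X Q →
      OffDiagConstOn Y Q → OffDiagConstOn (X * Y) Q := by
    intro X hX Y hY hXc hYc u hu w hw u' hu' w' hw' hne hne'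
    rw [Matrix.mul_apply, Matrix.mul_apply, sum_eq_sum_add_sum_of_cover hd hcov,
      sum_eq_sum_add_sum_of_cover hd hcov,
      hC.sum_mul_offDiag hQ hX hY hXc hYc hu hw hu' hw' hne hne']
    congr 1
    obtain ⟨p, q, hpq⟩ := hC.exists_affine hP hQ hd hcov h2 (hS.transpose_mem X hX)
    obtain ⟨p', q', hpq'⟩ := hC.exists_affine hP hQ hd hcov h2 hY
    -- Both blocks between `P` and `Q` are affine in `A`, so the sum over `P` reduces to row and
    -- column sums of `A` and to the count in `hAP`.
    have hexp : ∀ u ∈ Q, ∀ w ∈ Q, ∑ z ∈ P, X u z * Y z w =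
        P.card * (p * p') + p * q' * ∑ z ∈ P, Γ.adjMatrix ℂ z w +
          q * p' * ∑ z ∈ P, Γ.adjMatrix ℂ u z +
          q * q' * ∑ z ∈ P, Γ.adjMatrix ℂ u z * Γ.adjMatrix ℂ z w := by
      intro u hu w hw
      rw [← nsmul_eq_mul, ← Finset.sum_const, Finset.mul_sum, Finset.mul_sum, Finset.mul_sum,
        ← Finset.sum_add_distrib, ← Finset.sum_add_distrib, ← Finset.sum_add_distrib]
      refine Finset.sum_congr rfl fun z hz => ?_
      have h1 : X u z = p + q * Γ.adjMatrix ℂ u z := by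
        have := hpq z hz u hu
        rw [Matrix.transpose_apply] at this
        rw [this]
        simp only [SimpleGraph.adjMatrix_apply, Γ.adj_comm z u]
      rw [h1, hpq' z hz w hw]
      ring
    rw [hexp u hu w hw, hexp u' hu' w' hw', hAP u hu w hw u' hu' w' hw' hne hne',
      hC.row_sum_eq hS hQ hP hAS hu hu', hC.col_sum_eq hS hQ hP hAS hw hw']
  have hle : coherentClosure Γ ≤ offDiagConstSubalgebra _ Q hmul :=
    (coherentClosure_isLeast Γ).2 ⟨isCoherentAlgebra_offDiagConstSubalgebra hS hmul, hAS, hAQ⟩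
  rw [hC.typeEntry_eq hS hQ hQ] at h3
  obtain ⟨t, ht⟩ := fibre_nonempty hQ
  have hmem : C.colour t t ∈ (Q ×ˢ Q).image fun p => C.colour p.1 p.2 :=
    Finset.mem_image.2 ⟨(t, t), Finset.mem_product.2 ⟨ht, ht⟩, rfl⟩
  -- Without the diagonal colour two colours remain, and their matrices are not constant off the
  -- diagonal.
  have hone : 1 < (((Q ×ˢ Q).image fun p => C.colour p.1 p.2).erase (C.colour t t)).card := by
    rw [Finset.card_erase_of_mem hmem, h3]
    norm_num
  obtain ⟨R, hR, R', hR', hne⟩ := Finset.one_lt_card.1 hone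
  rw [Finset.mem_erase] at hR hR'
  obtain ⟨hRt, hR⟩ := hR
  obtain ⟨hRt', hR'⟩ := hR'
  obtain ⟨⟨u, w⟩, hp, rfl⟩ := Finset.mem_image.1 hR
  obtain ⟨⟨u', w'⟩, hp', rfl⟩ := Finset.mem_image.1 hR'
  rw [Finset.mem_product] at hp hp'
  simp only at hp hp' hRt hRt' hne
  have hoff : ∀ {a b}, a ∈ Q → C.colour a b ≠ C.colour t t → a ≠ b := by
    rintro a b ha h rfl
    exact h ((mem_fibre_iff hQ ht a).1 ha)
  have := (hle (hC.relMatrix_mem (C.colour_mem u w))).2 u hp.1 w hp.2 u' hp'.1 w' hp'.2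
    (hoff hp.1 hRt) (hoff hp'.1 hRt')
  simp [relMatrix_apply, C.mem_colour, mem_colour_iff, Ne.symm hne] at this

theorem IsConfigurationOf.colour_eq_of_adj_iff_of_three
    (hC : C.IsConfigurationOf (coherentClosure Γ)) (hQ : Q ∈ C.fibres)
    (h3 : C.typeEntry Q Q = 3)
    (h : (∃ u ∈ Q, ∃ w ∈ Q, Γ.Adj u w) ∧ ∃ u ∈ Q, ∃ w ∈ Q, u ≠ w ∧ ¬ Γ.Adj u w)
    {u w u' w' : V} (hu : u ∈ Q) (hw : w ∈ Q) (hu' : u' ∈ Q) (hw' : w' ∈ Q) (hne : u ≠ w)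
    (hne' : u' ≠ w') (hadj : Γ.Adj u w ↔ Γ.Adj u' w') : C.colour u w = C.colour u' w' := by
  have hS := isCoherentAlgebra_coherentClosure Γ
  obtain ⟨⟨a, ha, b, hb, hab⟩, c, hc, d, hd', hcd', hcd⟩ := h
  have hdist : ∀ {a b c d}, Γ.Adj a b → ¬ Γ.Adj c d → C.colour a b ≠ C.colour c d := by
    intro a b c d hab hcd h
    have := hC.apply_eq (adjMatrix_mem_coherentClosure Γ) h
    simp [hab, hcd] at this
  have hdiag : ∀ {a b}, a ≠ b → C.colour a b ≠ C.colour u u := fun hne h =>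
    hne (hC.eq_of_colour_diag h)
  rw [hC.typeEntry_eq hS hQ hQ] at h3
  have hmem : ∀ {a b}, a ∈ Q → b ∈ Q →
      C.colour a b ∈ (Q ×ˢ Q).image fun p => C.colour p.1 p.2 := fun {a b} ha hb =>
    Finset.mem_image.2 ⟨(a, b), Finset.mem_product.2 ⟨ha, hb⟩, rfl⟩
  by_contra hcol
  -- Together with the diagonal colour these would be four colours on `Q × Q`.
  have hcard : ∀ a b, a ∈ Q → b ∈ Q → a ≠ b →
      C.colour a b ≠ C.colour u w → C.colour a b ≠ C.colour u' w' → False := by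
    intro a b ha hb hab h1 h2
    have : ({C.colour a b, C.colour u w, C.colour u' w', C.colour u u} : Finset _) ⊆
        (Q ×ˢ Q).image fun p => C.colour p.1 p.2 := by
      simp only [Finset.insert_subset_iff, Finset.singleton_subset_iff]
      exact ⟨hmem ha hb, hmem hu hw, hmem hu' hw', hmem hu hu⟩
    have h4 := Finset.card_le_card this
    rw [h3, Finset.card_insert_of_notMem, Finset.card_insert_of_notMem,
      Finset.card_insert_of_notMem, Finset.card_singleton] at h4
    · omega
    · simpa using hdiag hne'
    · simpa using ⟨hcol, hdiag hne⟩
    · simpa using ⟨h1, h2, hdiag hab⟩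
  by_cases h1 : Γ.Adj u w
  · exact hcard c d hc hd' hcd' (hdist h1 hcd).symm (hdist (hadj.1 h1) hcd).symm
  · exact hcard a b ha hb hab.ne (hdist hab h1) (hdist hab fun h3 => h1 (hadj.2 h3))

end CoherentConfiguration

/-! ### The regular case has a single fibre -/

/-- The span of `I`, `A`, `J` for a strongly regular graph. -/
def spanOneAdjOnes {V : Type*} [Fintype V] [DecidableEq V] (A J : Matrix V V ℂ) (n p q s d : ℂ)
    (hJ : J * J = n • J) (hA : A * A = p • A + q • (1 : Matrix V V ℂ) + s • J)
    (hAJ : A * J = d • J) (hJA : J * A = d • J) : Subalgebra ℂ (Matrix V V ℂ) where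
  carrier := {X | ∃ x y z : ℂ, X = x • (1 : Matrix V V ℂ) + y • A + z • J}
  mul_mem' := by
    rintro _ _ ⟨x, y, z, rfl⟩ ⟨x', y', z', rfl⟩
    refine ⟨x * x' + y * y' * q, x * y' + y * x' + y * y' * p,
      x * z' + z * x' + y * z' * d + z * y' * d + z * z' * n + y * y' * s, ?_⟩
    simp only [add_mul, mul_add, Matrix.smul_mul, Matrix.mul_smul, one_mul, mul_one, hJ, hA, hAJ,
      hJA]
    module
  add_mem' := by
    rintro _ _ ⟨x, y, z, rfl⟩ ⟨x', y', z', rfl⟩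
    exact ⟨x + x', y + y', z + z', by module⟩
  algebraMap_mem' := fun c => ⟨c, 0, 0, by simp [Algebra.algebraMap_eq_smul_one]⟩

/-- The coherent closure of a strongly regular graph has only one fibre. -/
theorem diag_eq_of_mem_coherentClosure {V : Type*} [Fintype V] [DecidableEq V]
    {Γ : SimpleGraph V} [DecidableRel Γ.Adj] {p q s : ℂ} {d : ℕ}
    (hdeg : ∀ u, Γ.degree u = d)
    (hA : Γ.adjMatrix ℂ * Γ.adjMatrix ℂ = p • Γ.adjMatrix ℂ + q • (1 : Matrix V V ℂ) +
      s • (Matrix.of fun _ _ => 1)) {X : Matrix V V ℂ} (hX : X ∈ coherentClosure Γ) (u w : V) :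
    X u u = X w w := by
  set A := Γ.adjMatrix ℂ with hAdef
  set J : Matrix V V ℂ := Matrix.of fun _ _ => 1 with hJdef
  have hJ : J * J = (Fintype.card V : ℂ) • J := by
    ext a b
    simp [Matrix.mul_apply, hJdef]
  have hAJ : A * J = (d : ℂ) • J := by
    ext a b
    have := Γ.sum_adjMatrix (R := ℂ) Finset.univ a
    rw [Finset.inter_univ, SimpleGraph.card_neighborFinset_eq_degree, hdeg] at this
    rw [Matrix.mul_apply]
    simp only [hJdef, Matrix.of_apply, mul_one, Matrix.smul_apply, smul_eq_mul]
    exact this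
  have hAt : Aᵀ = A := Γ.isSymm_adjMatrix
  have hJA : J * A = (d : ℂ) • J := by
    have := congrArg Matrix.transpose hAJ
    rwa [Matrix.transpose_mul, hAt, Matrix.transpose_smul] at this
  have hcoh : IsCoherentAlgebra (spanOneAdjOnes A J _ p q s d hJ hA hAJ hJA) := by
    refine ⟨⟨0, 0, 1, by simp [hJdef]⟩, ?_, ?_⟩
    · rintro _ ⟨x, y, z, rfl⟩
      refine ⟨x, y, z, ?_⟩
      simp only [Matrix.transpose_add, Matrix.transpose_smul, Matrix.transpose_one, hAt]
      rfl
    · rintro _ ⟨x, y, z, rfl⟩ _ ⟨x', y', z', rfl⟩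
      -- Entrywise, `I` and `A` are idempotent and have product zero because there are no loops, and
      -- `J` is neutral.
      refine ⟨x * x' + x * z' + z * x', y * y' + y * z' + z * y', z * z', ?_⟩
      ext a b
      simp only [hAdef, hJdef, Matrix.hadamard_apply, Matrix.add_apply, Matrix.smul_apply,
        Matrix.one_apply, SimpleGraph.adjMatrix_apply, Matrix.of_apply, smul_eq_mul]
      by_cases hab : a = b
      · subst hab
        simp
        ring
      · split_ifs
        · simp
          ring
        · simp
  obtain ⟨x, y, z, rfl⟩ := (coherentClosure_isLeast Γ).2
    ⟨hcoh, ⟨0, 1, 0, by simp [hAdef]⟩⟩ hX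
  simp [hAdef, hJdef]

/-! ### Combinatorial data extracted from the type -/

/-- A biregular graph with valency partition `{P, Q}` for which the numbers of common neighbours
inside the other class of two distinct vertices of `P`, and of two distinct vertices of `Q`,
depend only on whether the vertices are adjacent; `P` is a clique or a coclique. -/
structure TwoFibreGraph {V : Type*} [Fintype V] [DecidableEq V] (Γ : SimpleGraph V)
    [DecidableRel Γ.Adj] (P Q : Finset V) (k₁ k₂ k₁₁ k₁₂ k₂₁ k₂₂ lam x y : ℕ) : Prop where
  disjoint : Disjoint P Q
  cover : ∀ u, u ∈ P ∨ u ∈ Q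
  ne : k₁ ≠ k₂
  degree₁ : ∀ u ∈ P, Γ.degree u = k₁
  degree₂ : ∀ u ∈ Q, Γ.degree u = k₂
  card₁₁ : ∀ u ∈ P, (Γ.neighborFinset u ∩ P).card = k₁₁
  card₁₂ : ∀ u ∈ P, (Γ.neighborFinset u ∩ Q).card = k₁₂
  card₂₁ : ∀ u ∈ Q, (Γ.neighborFinset u ∩ P).card = k₂₁
  card₂₂ : ∀ u ∈ Q, (Γ.neighborFinset u ∩ Q).card = k₂₂
  exists_ne : ∃ u ∈ P, ∃ w ∈ P, u ≠ w
  adj_iff : ∀ u ∈ P, ∀ w ∈ P, ∀ u' ∈ P, ∀ w' ∈ P, u ≠ w → u' ≠ w' → (Γ.Adj u w ↔ Γ.Adj u' w')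
  exists_adj₁₂ : ∃ u ∈ P, ∃ w ∈ Q, Γ.Adj u w
  exists_not_adj₁₂ : ∃ u ∈ P, ∃ w ∈ Q, ¬ Γ.Adj u w
  exists_adj₂₂ : ∃ u ∈ Q, ∃ w ∈ Q, Γ.Adj u w
  exists_not_adj₂₂ : ∃ u ∈ Q, ∃ w ∈ Q, u ≠ w ∧ ¬ Γ.Adj u w
  inter₁ : ∀ u ∈ P, ∀ w ∈ P, u ≠ w →
    (Γ.neighborFinset u ∩ Γ.neighborFinset w ∩ Q).card = lam
  inter_adj : ∀ u ∈ Q, ∀ w ∈ Q, Γ.Adj u w →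
    (Γ.neighborFinset u ∩ Γ.neighborFinset w ∩ P).card = x
  inter_not_adj : ∀ u ∈ Q, ∀ w ∈ Q, u ≠ w → ¬ Γ.Adj u w →
    (Γ.neighborFinset u ∩ Γ.neighborFinset w ∩ P).card = y

/-- Both sides count common neighbours. This links the real spectral identity to the complex
coherent algebra. -/
theorem adjMatrix_complex_mul_self {V : Type*} [Fintype V] [DecidableEq V] (Γ : SimpleGraph V)
    [DecidableRel Γ.Adj] (u w : V) : (Γ.adjMatrix ℂ * Γ.adjMatrix ℂ) u w =
      (((Γ.adjMatrix ℝ * Γ.adjMatrix ℝ) u w : ℝ) : ℂ) := by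
  rw [Matrix.mul_apply, Matrix.mul_apply, SimpleGraph.sum_adjMatrix_mul_adjMatrix,
    SimpleGraph.sum_adjMatrix_mul_adjMatrix, Complex.ofReal_natCast]

/-- This is the diagonal of the rank-one identity. Since `a` is positive, equal degrees force equal
entries of `a`. -/
theorem degree_eq_of_pos_vector {V : Type*} [Fintype V] [DecidableEq V] {Γ : SimpleGraph V}
    [DecidableRel Γ.Adj] {θ₁ θ₂ : ℝ} {a : V → ℝ}
    (ha : ∀ u v, (Γ.adjMatrix ℝ * Γ.adjMatrix ℝ) u v =
      (θ₁ + θ₂) * Γ.adjMatrix ℝ u v - θ₁ * θ₂ * (1 : Matrix V V ℝ) u v + a u * a v) (u : V) :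
    (Γ.degree u : ℝ) + θ₁ * θ₂ = a u * a u := by
  have h := ha u u
  rw [Matrix.mul_apply, SimpleGraph.sum_adjMatrix_mul_adjMatrix, Finset.inter_univ,
    Finset.inter_self, SimpleGraph.card_neighborFinset_eq_degree] at h
  rw [h]
  simp

open CoherentConfiguration in
theorem exists_twoFibreGraph {V : Type*} [Fintype V] [DecidableEq V] {Γ : SimpleGraph V}
    [DecidableRel Γ.Adj] {θ₁ θ₂ : ℝ} {a : V → ℝ} (hpos : ∀ u, 0 < a u)
    (ha : ∀ u v, (Γ.adjMatrix ℝ * Γ.adjMatrix ℝ) u v =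
      (θ₁ + θ₂) * Γ.adjMatrix ℝ u v - θ₁ * θ₂ * (1 : Matrix V V ℝ) u v + a u * a v)
    {C : CoherentConfiguration V} (hC : C.IsConfigurationOf (coherentClosure Γ))
    {F : Fin 2 → Finset V} (hT : C.HasType F !![2, 2; 2, 3]) :
    ∃ k₁ k₂ k₁₁ k₁₂ k₂₁ k₂₂ lam x y : ℕ,
      TwoFibreGraph Γ (F 0) (F 1) k₁ k₂ k₁₁ k₁₂ k₂₁ k₂₂ lam x y := by
  have hS := isCoherentAlgebra_coherentClosure Γ
  have hA := adjMatrix_mem_coherentClosure Γ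
  have hP : F 0 ∈ C.fibres := hT.range_eq ▸ ⟨0, rfl⟩
  have hQ : F 1 ∈ C.fibres := hT.range_eq ▸ ⟨1, rfl⟩
  have hcov : ∀ u, u ∈ F 0 ∨ u ∈ F 1 := by
    intro u
    obtain ⟨G, hG, hu⟩ := hC.exists_fibre u
    rw [← hT.range_eq] at hG
    obtain ⟨i, rfl⟩ := hG
    fin_cases i
    · exact Or.inl hu
    · exact Or.inr hu
  have hd : Disjoint (F 0) (F 1) := by
    rw [Finset.disjoint_left]
    intro u hu hu'
    exact absurd (hT.injective (fibre_eq hP hQ hu hu')) (by decide)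
  have h11 : C.typeEntry (F 0) (F 0) = 2 := by simpa using hT.typeEntry_eq 0 0
  have h12 : C.typeEntry (F 0) (F 1) = 2 := by simpa using hT.typeEntry_eq 0 1
  have h22 : C.typeEntry (F 1) (F 1) = 3 := by simpa using hT.typeEntry_eq 1 1
  generalize F 0 = P at *
  generalize F 1 = Q at *
  clear hT F
  have hcard : ∀ {F G}, F ∈ C.fibres → G ∈ C.fibres → ∀ {u u'}, u ∈ F → u' ∈ F →
      (Γ.neighborFinset u ∩ G).card = (Γ.neighborFinset u' ∩ G).card := by
    intro F G hF hG u u' hu hu'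
    have := hC.row_sum_eq hS hF hG hA hu hu'
    rw [SimpleGraph.sum_adjMatrix, SimpleGraph.sum_adjMatrix] at this
    exact_mod_cast this
  have hinter : ∀ {G}, G ∈ C.fibres → ∀ {u w u' w'}, C.colour u w = C.colour u' w' →
      (Γ.neighborFinset u ∩ Γ.neighborFinset w ∩ G).card =
        (Γ.neighborFinset u' ∩ Γ.neighborFinset w' ∩ G).card := by
    intro G hG u w u' w' h
    have := hC.partial_mul_eq hG hA hA h
    rw [SimpleGraph.sum_adjMatrix_mul_adjMatrix, SimpleGraph.sum_adjMatrix_mul_adjMatrix] at this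
    exact_mod_cast this
  have hdeg : ∀ {F}, F ∈ C.fibres → ∀ {u u'}, u ∈ F → u' ∈ F → Γ.degree u = Γ.degree u' := by
    intro F hF u u' hu hu'
    have h := hC.apply_eq (Subalgebra.mul_mem _ hA hA) ((mem_fibre_iff hF hu' u).1 hu)
    rw [Matrix.mul_apply, Matrix.mul_apply, SimpleGraph.sum_adjMatrix_mul_adjMatrix,
      SimpleGraph.sum_adjMatrix_mul_adjMatrix, Finset.inter_univ, Finset.inter_univ,
      Finset.inter_self, Finset.inter_self] at h
    exact_mod_cast h
  have hadeg : ∀ {u w}, Γ.degree u = Γ.degree w → a u = a w := by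
    intro u w h
    have h1 := degree_eq_of_pos_vector ha u
    rw [h, degree_eq_of_pos_vector ha w] at h1
    exact ((mul_self_inj (hpos w).le (hpos u).le).1 h1).symm
  have hA2 : OffDiagConstOn (Γ.adjMatrix ℂ) Q →
      OffDiagConstOn (Γ.adjMatrix ℂ * Γ.adjMatrix ℂ) Q := by
    intro h u hu w hw u' hu' w' hw' hne hne'
    have h1 := h u hu w hw u' hu' w' hw' hne hne'
    have h2 : Γ.adjMatrix ℝ u w = Γ.adjMatrix ℝ u' w' := by
      simp only [SimpleGraph.adjMatrix_apply] at h1 ⊢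
      split_ifs at h1 ⊢ <;> simp_all
    rw [adjMatrix_complex_mul_self, adjMatrix_complex_mul_self, ha, ha, h2,
      Matrix.one_apply_ne hne, Matrix.one_apply_ne hne', hadeg (hdeg hQ hu hu'),
      hadeg (hdeg hQ hw hw')]
  have hne := hC.exists_ne_of_typeEntry hS hP (by omega)
  have hPQ := hC.exists_adj_not_adj hP hQ hd hcov h12
  have hQQ := hC.exists_adj_not_adj_of_three hP hQ hd hcov h12 h22 hA2
  obtain ⟨p, hp, p', hp', hpp⟩ := id hne
  obtain ⟨⟨b, hb, c, hc, hbc⟩, b', hb', c', hc', hbc', hnbc⟩ := id hQQ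
  refine ⟨Γ.degree p, Γ.degree b, (Γ.neighborFinset p ∩ P).card, (Γ.neighborFinset p ∩ Q).card,
    (Γ.neighborFinset b ∩ P).card, (Γ.neighborFinset b ∩ Q).card,
    (Γ.neighborFinset p ∩ Γ.neighborFinset p' ∩ Q).card,
    (Γ.neighborFinset b ∩ Γ.neighborFinset c ∩ P).card,
    (Γ.neighborFinset b' ∩ Γ.neighborFinset c' ∩ P).card,
    { disjoint := hd
      cover := hcov
      ne := ?_
      degree₁ := fun u hu => hdeg hP hu hp
      degree₂ := fun u hu => hdeg hQ hu hb
      card₁₁ := fun u hu => hcard hP hP hu hp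
      card₁₂ := fun u hu => hcard hP hQ hu hp
      card₂₁ := fun u hu => hcard hQ hP hu hb
      card₂₂ := fun u hu => hcard hQ hQ hu hb
      exists_ne := hne
      adj_iff := ?_
      exists_adj₁₂ := hPQ.1
      exists_not_adj₁₂ := hPQ.2
      exists_adj₂₂ := hQQ.1
      exists_not_adj₂₂ := hQQ.2
      inter₁ := fun u hu w hw h => hinter hQ
        (hC.colour_eq_of_typeEntry_eq_two hS hP h11 hu hw hp hp' h hpp)
      inter_adj := fun u hu w hw h => hinter hP
        (hC.colour_eq_of_adj_iff_of_three hQ h22 hQQ hu hw hb hc h.ne hbc.ne (by tauto))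
      inter_not_adj := fun u hu w hw h h' => hinter hP
        (hC.colour_eq_of_adj_iff_of_three hQ h22 hQQ hu hw hb' hc' h hbc' (by tauto)) }⟩
  -- For equal degrees `a` is constant and `A²` lies in the span of `A`, `I`, `J`. The diagonal
  -- idempotent of `P` would then have a constant diagonal, although it separates `p` from `b`.
  · intro heq
    have hreg : ∀ u, Γ.degree u = Γ.degree p := by
      intro u
      rcases hcov u with hu | hu
      · exact hdeg hP hu hp
      · exact (hdeg hQ hu hb).trans heq.symm
    have hsq : Γ.adjMatrix ℂ * Γ.adjMatrix ℂ = ((θ₁ + θ₂ : ℝ) : ℂ) • Γ.adjMatrix ℂ +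
        ((-(θ₁ * θ₂) : ℝ) : ℂ) • (1 : Matrix V V ℂ) +
        ((a p * a p : ℝ) : ℂ) • (Matrix.of fun _ _ => 1) := by
      ext u w
      rw [adjMatrix_complex_mul_self, ha, hadeg (hreg u), hadeg (hreg w)]
      simp only [Matrix.add_apply, Matrix.smul_apply, SimpleGraph.adjMatrix_apply,
        Matrix.one_apply, Matrix.of_apply, smul_eq_mul]
      split_ifs <;> push_cast <;> ring
    have h := diag_eq_of_mem_coherentClosure hreg hsq (hC.diagonal_mem hP) p b
    have hbP : b ∉ P := fun h => Finset.disjoint_left.1 hd h hb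
    simp [hp, hbP] at h
  · intro u hu w hw u' hu' w' hw' hne hne'
    have h := hC.apply_eq hA (hC.colour_eq_of_typeEntry_eq_two hS hP h11 hu hw hu' hw' hne hne')
    simp only [SimpleGraph.adjMatrix_apply] at h
    split_ifs at h <;> simp_all

/-! ### Restricted eigenvalues of a matrix quadratic modulo `J` -/

theorem ones_mulVec {m n : Type*} [Fintype n] (u : n → ℝ) :
    (Matrix.of fun _ _ => 1 : Matrix m n ℝ) *ᵥ u = fun _ => ∑ j, u j := by
  funext i
  simp [Matrix.mulVec, dotProduct]

section Restricted

variable {n : Type*} [Fintype n] [DecidableEq n] {B : Matrix n n ℝ}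

/-- A symmetric matrix acting as a scalar on the orthogonal complement of the all-ones vector has
constant off-diagonal entries. -/
theorem apply_eq_of_scalar_on_orthogonal (hsymm : Bᵀ = B) {e : ℝ}
    (h : ∀ w : n → ℝ, ∑ i, w i = 0 → B *ᵥ w = e • w) {i j k l : n} (hij : i ≠ j) (hkl : k ≠ l) :
    B i j = B k l := by
  have hs : ∀ a b, B a b = B b a := fun a b => congrFun (congrFun hsymm b) a
  -- Differences of two unit vectors as test vectors show that each row of `B - e I` is constant;
  -- symmetry then links different rows.
  have hc : ∀ a b b', B a b - e * (1 : Matrix n n ℝ) a b =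
      B a b' - e * (1 : Matrix n n ℝ) a b' := by
    intro a b b'
    have h1 := congrFun (h (Pi.single b 1 - Pi.single b' 1) (by simp)) a
    simp only [Matrix.mulVec_sub, Matrix.mulVec_single_one, Pi.sub_apply, Matrix.col_apply,
      Pi.smul_apply, smul_eq_mul, Pi.single_apply] at h1
    simp only [Matrix.one_apply]
    linarith
  have hs1 : ∀ a b, (1 : Matrix n n ℝ) a b = (1 : Matrix n n ℝ) b a := fun a b => by
    simp [Matrix.one_apply, eq_comm]
  have h1 := hc i j k
  have h2 := hc k i l
  rw [hs i k, hs1 i k] at h1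
  have := h1.trans h2
  simpa [Matrix.one_apply_ne hij, Matrix.one_apply_ne hkl] using this

/-- A symmetric matrix with constant column sums satisfying a quadratic equation modulo the
all-ones matrix has exactly two restricted eigenvalues, unless its off-diagonal entries are
constant. -/
theorem exists_two_restricted_eigenvalues (hsymm : Bᵀ = B) {k p q s : ℝ}
    (hsum : ∀ j, ∑ i, B i j = k)
    (hB : B * B = p • B + q • (1 : Matrix n n ℝ) + s • (Matrix.of fun _ _ => 1)) {i j i' j' : n}
    (hij : i ≠ j) (hij' : i' ≠ j') (hne : B i j ≠ B i' j') :
    ∃ e₁ e₂ : ℝ, e₂ < e₁ ∧ e₁ + e₂ = p ∧ e₁ * e₂ = -q ∧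
      {e | ∃ u : n → ℝ, u ≠ 0 ∧ ∑ w, u w = 0 ∧ B *ᵥ u = e • u} = {e₁, e₂} := by
  have hperp : ∀ w : n → ℝ, ∑ i, w i = 0 → ∑ i, (B *ᵥ w) i = 0 := by
    intro w hw
    simp only [Matrix.mulVec, dotProduct]
    rw [Finset.sum_comm]
    simp only [← Finset.sum_mul, hsum]
    rw [← Finset.mul_sum, hw, mul_zero]
  have hsq : ∀ w : n → ℝ, ∑ i, w i = 0 → B *ᵥ (B *ᵥ w) = p • (B *ᵥ w) + q • w := by
    intro w hw
    rw [Matrix.mulVec_mulVec, hB, Matrix.add_mulVec, Matrix.add_mulVec, Matrix.smul_mulVec,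
      Matrix.smul_mulVec, Matrix.smul_mulVec, ones_mulVec, hw, Matrix.one_mulVec]
    ext
    simp
  have hnot : ∀ e : ℝ, ∃ w : n → ℝ, ∑ i, w i = 0 ∧ B *ᵥ w ≠ e • w := by
    intro e
    by_contra! h
    exact hne (apply_eq_of_scalar_on_orthogonal hsymm h hij hij')
  -- On the complement of the all-ones vector `(B - p/2)² = p²/4 + q`. By symmetry `‖(B - p/2) w‖² =
  -- (p²/4 + q)‖w‖²`, which is positive for some `w` because `B` is not a scalar there.
  have hD : 0 < p ^ 2 / 4 + q := by
    obtain ⟨w, hw, hwe⟩ := hnot (p / 2)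
    have hz : B *ᵥ w - (p / 2) • w ≠ 0 := sub_ne_zero.2 hwe
    have h1 : (B *ᵥ w - (p / 2) • w) ⬝ᵥ (B *ᵥ w - (p / 2) • w) =
        (p ^ 2 / 4 + q) * (w ⬝ᵥ w) := by
      have h2 : (B *ᵥ w) ⬝ᵥ (B *ᵥ w) = w ⬝ᵥ (B *ᵥ (B *ᵥ w)) := by
        rw [Matrix.dotProduct_mulVec w, ← Matrix.mulVec_transpose, hsymm]
      rw [hsq w hw] at h2
      simp only [sub_dotProduct, dotProduct_sub, smul_dotProduct, dotProduct_smul, h2,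
        dotProduct_add, smul_eq_mul]
      rw [dotProduct_comm (B *ᵥ w) w]
      ring
    have h3 : 0 < (B *ᵥ w - (p / 2) • w) ⬝ᵥ (B *ᵥ w - (p / 2) • w) := by
      simpa using Matrix.dotProduct_star_self_pos_iff.2 hz
    have h4 : 0 ≤ w ⬝ᵥ w := by simpa using dotProduct_star_self_nonneg w
    rw [h1] at h3
    exact pos_of_mul_pos_left h3 h4
  set d := √(p ^ 2 / 4 + q) with hd
  have hdpos : 0 < d := Real.sqrt_pos.2 hD
  have hdd : d * d = p ^ 2 / 4 + q := Real.mul_self_sqrt hD.le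
  -- There `(B - e)(B - e') = 0`, so any nonzero vector `(B - e') w` is an eigenvector for `e`.
  have hex : ∀ e e' : ℝ, e + e' = p → e * e' = -q →
      ∃ u : n → ℝ, u ≠ 0 ∧ ∑ w, u w = 0 ∧ B *ᵥ u = e • u := by
    intro e e' h1 h2
    obtain ⟨w, hw, hwe⟩ := hnot e'
    refine ⟨B *ᵥ w - e' • w, sub_ne_zero.2 hwe, ?_, ?_⟩
    · simp [hperp w hw, ← Finset.mul_sum, hw]
    · rw [Matrix.mulVec_sub, Matrix.mulVec_smul, hsq w hw, ← h1, (by linarith : q = -(e * e'))]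
      module
  refine ⟨p / 2 + d, p / 2 - d, by linarith, by ring, by linear_combination -hdd, ?_⟩
  ext e
  simp only [Set.mem_ofPred_eq, Set.mem_insert_iff, Set.mem_singleton_iff]
  constructor
  · rintro ⟨u, hu, hs, he⟩
    have h1 := hsq u hs
    rw [he, Matrix.mulVec_smul, he] at h1
    obtain ⟨t, ht⟩ := Function.ne_iff.1 hu
    have h2 := congrFun h1 t
    simp only [Pi.add_apply, Pi.smul_apply, smul_eq_mul] at h2
    have h3 : e * e = p * e + q := mul_right_cancel₀ ht (by linear_combination h2)
    have h4 : (e - (p / 2 + d)) * (e - (p / 2 - d)) = 0 := by linear_combination h3 - hdd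
    rcases mul_eq_zero.1 h4 with h | h
    · left; linarith
    · right; linarith
  · rintro (rfl | rfl)
    · exact hex _ (p / 2 - d) (by ring) (by linear_combination -hdd)
    · exact hex _ (p / 2 + d) (by ring) (by linear_combination -hdd)

end Restricted

/-! ### Identities between the incidence matrix and the block graph -/

section Blocks

variable {m n : Type*} [Fintype m] [Fintype n] [DecidableEq n]
  {M : Matrix m n ℝ} {B : Matrix n n ℝ} {k r lam x y c s θ₁ θ₂ t : ℝ}

/-- Associativity of `MMᵀM` gives an equation between combinations of `M` and `J`. An entry of `M`
equal to one and an entry equal to zero separate the two coefficients. -/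
theorem block_parameter_equations [DecidableEq m] (hcol : ∀ j, ∑ i, M i j = k) (hrow : ∀ i, ∑ j, M i j = r)
    (hMMt : M * Mᵀ = (r - lam) • (1 : Matrix m m ℝ) + lam • (Matrix.of fun _ _ => 1))
    (hMtM : Mᵀ * M = (k - y) • (1 : Matrix n n ℝ) + (x - y) • B + y • (Matrix.of fun _ _ => 1))
    (hMB : M * B = s • M + c • (Matrix.of fun _ _ => 1)) {i i' : m} {j j' : n} (h1 : M i j = 1)
    (h0 : M i' j' = 0) : (x - y) * c = lam * k - y * r ∧ (x - y) * s = r - lam + y - k := by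
  have h : M * Mᵀ * M = M * (Mᵀ * M) := Matrix.mul_assoc _ _ _
  rw [hMMt, hMtM] at h
  have hJM : (Matrix.of fun _ _ => 1 : Matrix m m ℝ) * M = k • (Matrix.of fun _ _ => 1) := by
    ext a b
    simp [Matrix.mul_apply, hcol]
  have hMJ : M * (Matrix.of fun _ _ => 1 : Matrix n n ℝ) = r • (Matrix.of fun _ _ => 1) := by
    ext a b
    simp [Matrix.mul_apply, hrow]
  simp only [Matrix.add_mul, Matrix.mul_add, Matrix.smul_mul, Matrix.mul_smul, Matrix.one_mul, Matrix.mul_one,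
    hJM, hMJ, hMB] at h
  have e1 := congrFun (congrFun h i) j
  have e0 := congrFun (congrFun h i') j'
  simp only [Matrix.add_apply, Matrix.smul_apply, Matrix.of_apply, smul_eq_mul, h1, h0] at e1 e0
  constructor <;> linarith

/-- Such a `u` is also an eigenvector of `MᵀM`. If `M u = 0`, the eigenvalue of `MᵀM` is zero and
the quadratic equation for `B` leaves only `θ₁` and `θ₂`. Otherwise `M u` is orthogonal to the
all-ones vector, so `MMᵀ` acts on it as `r - lam`; comparing eigenvalues gives `e = s`. -/
theorem restricted_eigenvalue_cases [DecidableEq m] (hxy : x ≠ y)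
    (hcol : ∀ j, ∑ i, M i j = k)
    (hMMt : M * Mᵀ = (r - lam) • (1 : Matrix m m ℝ) + lam • (Matrix.of fun _ _ => 1))
    (hMtM : Mᵀ * M = (k - y) • (1 : Matrix n n ℝ) + (x - y) • B + y • (Matrix.of fun _ _ => 1))
    (hB : B * B + Mᵀ * M =
      (θ₁ + θ₂) • B - (θ₁ * θ₂) • (1 : Matrix n n ℝ) + t • (Matrix.of fun _ _ => 1))
    (hs : (x - y) * s = r - lam + y - k) {e : ℝ} {u : n → ℝ} (hu : u ≠ 0) (hu0 : ∑ j, u j = 0)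
    (he : B *ᵥ u = e • u) : (e = (y - k) / (x - y) ∧ (e = θ₁ ∨ e = θ₂)) ∨ e = s := by
  have hxy' : x - y ≠ 0 := sub_ne_zero.2 hxy
  obtain ⟨a, ha⟩ := Function.ne_iff.1 hu
  have hμ : Mᵀ *ᵥ (M *ᵥ u) = (k - y + (x - y) * e) • u := by
    rw [Matrix.mulVec_mulVec, hMtM, Matrix.add_mulVec, Matrix.add_mulVec, Matrix.smul_mulVec,
      Matrix.smul_mulVec, Matrix.smul_mulVec, ones_mulVec, hu0, Matrix.one_mulVec, he]
    ext
    simp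
    ring
  by_cases hv : M *ᵥ u = 0
  · left
    rw [hv, Matrix.mulVec_zero] at hμ
    have h1 : k - y + (x - y) * e = 0 := by
      have := congrFun hμ a
      simp only [Pi.zero_apply, Pi.smul_apply, smul_eq_mul] at this
      exact (mul_eq_zero.1 this.symm).resolve_right ha
    refine ⟨by rw [eq_div_iff hxy']; linarith, ?_⟩
    have h2 := congrArg (· *ᵥ u) hB
    simp only [Matrix.add_mulVec, Matrix.sub_mulVec, ← Matrix.mulVec_mulVec, hv, he,
      Matrix.mulVec_zero, Matrix.mulVec_smul, Matrix.smul_mulVec, ones_mulVec, hu0,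
      Matrix.one_mulVec] at h2
    have h3 := congrFun h2 a
    simp only [Pi.add_apply, Pi.sub_apply, Pi.smul_apply, Pi.zero_apply, smul_eq_mul] at h3
    have h4 : (e - θ₁) * (e - θ₂) = 0 :=
      (mul_eq_zero.1 (by linear_combination h3 : (e - θ₁) * (e - θ₂) * u a = 0)).resolve_right ha
    rcases mul_eq_zero.1 h4 with h | h
    · left; linarith
    · right; linarith
  · right
    obtain ⟨b, hb⟩ := Function.ne_iff.1 hv
    have h0 : ∑ i, (M *ᵥ u) i = 0 := by
      simp only [Matrix.mulVec, dotProduct]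
      rw [Finset.sum_comm]
      simp only [← Finset.sum_mul, hcol]
      rw [← Finset.mul_sum, hu0, mul_zero]
    have h1 : M *ᵥ (Mᵀ *ᵥ (M *ᵥ u)) = (r - lam) • (M *ᵥ u) := by
      rw [Matrix.mulVec_mulVec, hMMt, Matrix.add_mulVec, Matrix.smul_mulVec, Matrix.smul_mulVec,
        ones_mulVec, h0, Matrix.one_mulVec]
      ext
      simp
    rw [hμ, Matrix.mulVec_smul] at h1
    have h2 := mul_right_cancel₀ hb (congrFun h1 b)
    apply mul_left_cancel₀ hxy'
    linarith

/-- If the columns of a `0-1` incidence structure had constant pairwise intersections, then the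
matrix `B` would have constant off-diagonal entries. -/
theorem apply_eq_of_constant_intersection {k₂₂ : ℝ} (hxk : k ≠ x) (hcol : ∀ j, ∑ i, M i j = k)
    (hBcol : ∀ j, ∑ i, B i j = k₂₂)
    (hMtM : Mᵀ * M = (k - x) • (1 : Matrix n n ℝ) + x • (Matrix.of fun _ _ => 1))
    (hMB : M * B = s • M + c • (Matrix.of fun _ _ => 1)) {i j i' j' : n} (hij : i ≠ j)
    (hij' : i' ≠ j') : B i j = B i' j' := by
  -- Expanding both sides expresses `(k - x) B` through `I` and `J`.
  have h : Mᵀ * M * B = Mᵀ * (M * B) := Matrix.mul_assoc _ _ _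
  rw [hMtM, hMB] at h
  have hJB : (Matrix.of fun _ _ => 1 : Matrix n n ℝ) * B = k₂₂ • (Matrix.of fun _ _ => 1) := by
    ext a b
    simp [Matrix.mul_apply, hBcol]
  have hMJ : Mᵀ * (Matrix.of fun _ _ => 1 : Matrix m n ℝ) = k • (Matrix.of fun _ _ => 1) := by
    ext a b
    simp [Matrix.mul_apply, hcol]
  simp only [Matrix.add_mul, Matrix.mul_add, Matrix.smul_mul, Matrix.mul_smul, Matrix.one_mul, hJB, hMJ, hMtM]
    at h
  have key : ∀ a b, a ≠ b → (k - x) * B a b + x * k₂₂ = s * x + c * k := by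
    intro a b hab
    have := congrFun (congrFun h a) b
    simpa [Matrix.one_apply_ne hab] using this
  exact mul_left_cancel₀ (sub_ne_zero.2 hxk) (by linarith [key i j hij, key i' j' hij'])

end Blocks

/-! ### The quasi-symmetric design between the fibres -/

theorem card_filter_subtype {V : Type*} (P : Finset V) (p : V → Prop) [DecidablePred p] :
    (Finset.univ.filter fun z : P => p z).card = (P.filter p).card := by
  rw [Finset.card_filter, Finset.card_filter]
  exact Finset.sum_coe_sort P fun z => if p z then 1 else 0

/-- The blocks of the incidence structure between `P` and `Q`: the neighbourhoods in `P` of the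
vertices in `Q`. -/
def neighborBlocks {V : Type*} (Γ : SimpleGraph V) [DecidableRel Γ.Adj] (P Q : Finset V) :
    Q → Finset P :=
  fun j => Finset.univ.filter fun p => Γ.Adj p j

namespace TwoFibreGraph

variable {V : Type*} [Fintype V] [DecidableEq V] {Γ : SimpleGraph V} [DecidableRel Γ.Adj]
  {P Q : Finset V} {k₁ k₂ k₁₁ k₁₂ k₂₁ k₂₂ lam x y : ℕ}

omit [Fintype V] in
theorem incidenceMatrix_apply (p : P) (j : Q) :
    incidenceMatrix (neighborBlocks Γ P Q) p j = Γ.adjMatrix ℝ p j := by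
  simp [incidenceMatrix, neighborBlocks]

theorem card_neighborBlocks (j : Q) :
    (neighborBlocks Γ P Q j).card = (Γ.neighborFinset j ∩ P).card := by
  rw [neighborBlocks, card_filter_subtype P fun z => Γ.Adj z j]
  congr 1
  ext z
  simp [and_comm, Γ.adj_comm]

theorem card_neighborBlocks_inter (i j : Q) :
    (neighborBlocks Γ P Q i ∩ neighborBlocks Γ P Q j).card =
      (Γ.neighborFinset i ∩ Γ.neighborFinset j ∩ P).card := by
  rw [neighborBlocks, neighborBlocks, ← Finset.filter_and,
    card_filter_subtype P fun z => Γ.Adj z i ∧ Γ.Adj z j]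
  congr 1
  ext z
  simp only [Finset.mem_filter, Finset.mem_inter, SimpleGraph.mem_neighborFinset, Γ.adj_comm z]
  tauto

theorem mul_transpose_eq (h : TwoFibreGraph Γ P Q k₁ k₂ k₁₁ k₁₂ k₂₁ k₂₂ lam x y) :
    incidenceMatrix (neighborBlocks Γ P Q) * (incidenceMatrix (neighborBlocks Γ P Q))ᵀ =
      ((k₁₂ : ℝ) - lam) • (1 : Matrix P P ℝ) + (lam : ℝ) • (Matrix.of fun _ _ => 1) := by
  ext p p'
  rw [Matrix.mul_apply]
  simp only [Matrix.transpose_apply, incidenceMatrix_apply]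
  rw [Finset.sum_coe_sort Q fun j => Γ.adjMatrix ℝ p j * Γ.adjMatrix ℝ p' j]
  have : ∀ j, Γ.adjMatrix ℝ p' j = Γ.adjMatrix ℝ j p' := fun j => by
    simp only [SimpleGraph.adjMatrix_apply, Γ.adj_comm]
  simp only [this]
  rw [SimpleGraph.sum_adjMatrix_mul_adjMatrix]
  by_cases hp : p = p'
  · subst hp
    rw [Finset.inter_self, h.card₁₂ p p.2]
    simp
  · rw [h.inter₁ p p.2 p' p'.2 fun h => hp (Subtype.ext h)]
    simp [hp]

theorem transpose_mul_eq (h : TwoFibreGraph Γ P Q k₁ k₂ k₁₁ k₁₂ k₂₁ k₂₂ lam x y) :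
    (incidenceMatrix (neighborBlocks Γ P Q))ᵀ * incidenceMatrix (neighborBlocks Γ P Q) =
      ((k₂₁ : ℝ) - y) • (1 : Matrix Q Q ℝ) +
        ((x : ℝ) - y) • (Γ.induce (Q : Set V)).adjMatrix ℝ +
        (y : ℝ) • (Matrix.of fun _ _ => 1) := by
  ext i j
  rw [Matrix.mul_apply]
  simp only [Matrix.transpose_apply, incidenceMatrix_apply]
  rw [Finset.sum_coe_sort P fun p => Γ.adjMatrix ℝ p i * Γ.adjMatrix ℝ p j]
  have : ∀ p, Γ.adjMatrix ℝ p i = Γ.adjMatrix ℝ i p := fun p => by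
    simp only [SimpleGraph.adjMatrix_apply, Γ.adj_comm]
  simp only [this]
  rw [SimpleGraph.sum_adjMatrix_mul_adjMatrix]
  by_cases hij : i = j
  · subst hij
    rw [Finset.inter_self, h.card₂₁ i i.2]
    simp
  · by_cases hadj : Γ.Adj i j
    · rw [h.inter_adj i i.2 j j.2 hadj]
      simp [hij, hadj]
    · rw [h.inter_not_adj i i.2 j j.2 (fun h => hij (Subtype.ext h)) hadj]
      simp [hij, hadj]

theorem sum_row (h : TwoFibreGraph Γ P Q k₁ k₂ k₁₁ k₁₂ k₂₁ k₂₂ lam x y) (p : P) :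
    ∑ j, incidenceMatrix (neighborBlocks Γ P Q) p j = k₁₂ := by
  simp only [incidenceMatrix_apply]
  rw [Finset.sum_coe_sort Q fun j => Γ.adjMatrix ℝ p j, SimpleGraph.sum_adjMatrix,
    h.card₁₂ p p.2]

theorem sum_col (h : TwoFibreGraph Γ P Q k₁ k₂ k₁₁ k₁₂ k₂₁ k₂₂ lam x y) (j : Q) :
    ∑ p, incidenceMatrix (neighborBlocks Γ P Q) p j = k₂₁ := by
  simp only [incidenceMatrix_apply]
  rw [Finset.sum_coe_sort P fun p => Γ.adjMatrix ℝ p j]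
  simp only [SimpleGraph.adjMatrix_apply, Γ.adj_comm _ (j : V)]
  rw [← h.card₂₁ j j.2, ← SimpleGraph.sum_adjMatrix (R := ℝ) Γ P j]
  simp only [SimpleGraph.adjMatrix_apply]

theorem sum_col_induce (h : TwoFibreGraph Γ P Q k₁ k₂ k₁₁ k₁₂ k₂₁ k₂₂ lam x y) (j : Q) :
    ∑ i : Q, (Γ.induce (Q : Set V)).adjMatrix ℝ i j = k₂₂ := by
  simp only [SimpleGraph.adjMatrix_apply, SimpleGraph.induce_adj, Γ.adj_comm _ (j : V)]
  rw [Finset.sum_coe_sort Q fun i => if Γ.Adj j i then (1 : ℝ) else 0, ← h.card₂₂ j j.2,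
    ← SimpleGraph.sum_adjMatrix (R := ℝ) Γ Q j]
  simp only [SimpleGraph.adjMatrix_apply]

theorem exists_adjMatrix_eq (h : TwoFibreGraph Γ P Q k₁ k₂ k₁₁ k₁₂ k₂₁ k₂₂ lam x y) :
    ∃ ε : ℝ, (ε = 0 ∨ ε = 1) ∧ ∀ u ∈ P, ∀ w ∈ P, u ≠ w → Γ.adjMatrix ℝ u w = ε := by
  obtain ⟨u, hu, w, hw, hne⟩ := h.exists_ne
  refine ⟨Γ.adjMatrix ℝ u w, ?_, fun a ha b hb hab => ?_⟩
  · rw [SimpleGraph.adjMatrix_apply]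
    split_ifs <;> simp
  · simp only [SimpleGraph.adjMatrix_apply, h.adj_iff a ha b hb u hu w hw hab hne]

/-- With equal intersection numbers the blocks either all coincide or form a structure in which
`MᵀM` is a combination of `I` and `J`. The latter makes `Γ[Q]` complete or empty. -/
theorem intersection_ne (h : TwoFibreGraph Γ P Q k₁ k₂ k₁₁ k₁₂ k₂₁ k₂₂ lam x y) {s c : ℝ}
    (hMB : incidenceMatrix (neighborBlocks Γ P Q) * (Γ.induce (Q : Set V)).adjMatrix ℝ =
      s • incidenceMatrix (neighborBlocks Γ P Q) + c • (Matrix.of fun _ _ => 1)) : x ≠ y := by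
  intro hxy
  have hMtM := h.transpose_mul_eq
  subst hxy
  rw [sub_self, zero_smul, add_zero] at hMtM
  by_cases hk : k₂₁ = x
  -- Two blocks meet in as many points as each contains, so all blocks are equal. A point on one
  -- block lies on all, and by the constant count `k₁₂` so does every point, against
  -- `exists_not_adj₁₂`.
  · obtain ⟨p, hp, j, hj, hpj⟩ := h.exists_adj₁₂
    have hall : ∀ j' ∈ Q, Γ.Adj p j' := by
      intro j' hj'
      by_cases hjj : j = j'
      · exact hjj ▸ hpj
      have hc : (Γ.neighborFinset j ∩ Γ.neighborFinset j' ∩ P).card =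
          (Γ.neighborFinset j ∩ P).card := by
        rw [h.card₂₁ j hj, hk]
        by_cases hadj : Γ.Adj j j'
        · exact h.inter_adj j hj j' hj' hadj
        · exact h.inter_not_adj j hj j' hj' hjj hadj
      have hsub : Γ.neighborFinset j ∩ Γ.neighborFinset j' ∩ P ⊆ Γ.neighborFinset j ∩ P :=
        Finset.inter_subset_inter_right Finset.inter_subset_left
      have hmem : p ∈ Γ.neighborFinset j ∩ P := by simp [hp, hpj.symm]
      rw [← Finset.eq_of_subset_of_card_le hsub hc.ge] at hmem
      simp only [Finset.mem_inter, SimpleGraph.mem_neighborFinset] at hmem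
      exact hmem.1.2.symm
    have hpQ : Γ.neighborFinset p ∩ Q = Q := by
      ext j'
      simpa using hall j'
    obtain ⟨p', hp', j', hj', hn⟩ := h.exists_not_adj₁₂
    have hc : Q.card ≤ (Γ.neighborFinset p' ∩ Q).card := by
      rw [h.card₁₂ p' hp', ← h.card₁₂ p hp, hpQ]
    have := Finset.eq_of_subset_of_card_le Finset.inter_subset_right hc
    rw [← this] at hj'
    simp only [Finset.mem_inter, SimpleGraph.mem_neighborFinset] at hj'
    exact hn hj'.1
  · obtain ⟨i, hi, j, hj, hij⟩ := h.exists_adj₂₂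
    obtain ⟨i', hi', j', hj', hne, hij'⟩ := h.exists_not_adj₂₂
    have := apply_eq_of_constant_intersection (by exact_mod_cast hk) h.sum_col
      h.sum_col_induce hMtM hMB (i := ⟨i, hi⟩) (j := ⟨j, hj⟩) (i' := ⟨i', hi'⟩) (j' := ⟨j', hj'⟩)
      (fun h => hij.ne (congrArg Subtype.val h)) (fun h => hne (congrArg Subtype.val h))
    simp [hij, hij'] at this

theorem isQSD (h : TwoFibreGraph Γ P Q k₁ k₂ k₁₁ k₁₂ k₂₁ k₂₂ lam x y) (hxy : x ≠ y) :
    IsQSD (neighborBlocks Γ P Q) P.card k₂₁ lam Q.card k₁₂ x y where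
  card_points := Fintype.card_coe P
  one_le := by
    obtain ⟨p, hp, j, hj, hpj⟩ := h.exists_adj₁₂
    rw [← h.card₂₁ j hj, Nat.one_le_iff_ne_zero, ← Nat.pos_iff_ne_zero, Finset.card_pos]
    exact ⟨p, by simp [hp, hpj.symm]⟩
  le := by
    obtain ⟨p, hp, j, hj, hpj⟩ := h.exists_adj₁₂
    rw [← h.card₂₁ j hj]
    exact Finset.card_le_card Finset.inter_subset_right
  card_block := fun j => by rw [card_neighborBlocks, h.card₂₁ j j.2]
  card_pair := by
    intro s hs
    obtain ⟨p, p', hne, rfl⟩ := Finset.card_eq_two.1 hs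
    rw [← h.inter₁ p p.2 p' p'.2 fun h => hne (Subtype.ext h)]
    have : ∀ j : Q, {p, p'} ⊆ neighborBlocks Γ P Q j ↔ Γ.Adj p j ∧ Γ.Adj p' j := by
      intro j
      simp [neighborBlocks, Finset.insert_subset_iff]
    simp only [this]
    rw [card_filter_subtype Q fun j => Γ.Adj p j ∧ Γ.Adj p' j]
    congr 1
    ext z
    simp only [Finset.mem_filter, Finset.mem_inter, SimpleGraph.mem_neighborFinset]
    tauto
  card_blocks := Fintype.card_coe Q
  card_through := by
    intro p
    have : ∀ j : Q, p ∈ neighborBlocks Γ P Q j ↔ Γ.Adj p j := fun j => by simp [neighborBlocks]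
    simp only [this]
    rw [card_filter_subtype Q fun j => Γ.Adj p j, ← h.card₁₂ p p.2]
    congr 1
    ext z
    simp [and_comm]
  ne := hxy
  inter := by
    intro i j hij
    rw [card_neighborBlocks_inter]
    by_cases hadj : Γ.Adj i j
    · exact Or.inl (h.inter_adj i i.2 j j.2 hadj)
    · exact Or.inr (h.inter_not_adj i i.2 j j.2 (fun h => hij (Subtype.ext h)) hadj)
  exists_x := by
    obtain ⟨i, hi, j, hj, hij⟩ := h.exists_adj₂₂
    refine ⟨⟨i, hi⟩, ⟨j, hj⟩, fun h => hij.ne (congrArg Subtype.val h), ?_⟩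
    rw [card_neighborBlocks_inter]
    exact h.inter_adj i hi j hj hij
  exists_y := by
    obtain ⟨i, hi, j, hj, hne, hij⟩ := h.exists_not_adj₂₂
    refine ⟨⟨i, hi⟩, ⟨j, hj⟩, fun h => hne (congrArg Subtype.val h), ?_⟩
    rw [card_neighborBlocks_inter]
    exact h.inter_not_adj i hi j hj hne hij

theorem induce_eq_blockGraph (h : TwoFibreGraph Γ P Q k₁ k₂ k₁₁ k₁₂ k₂₁ k₂₂ lam x y)
    (hxy : x ≠ y) : Γ.induce (Q : Set V) = blockGraph (neighborBlocks Γ P Q) x := by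
  ext i j
  change Γ.Adj i j ↔ i ≠ j ∧ (neighborBlocks Γ P Q i ∩ neighborBlocks Γ P Q j).card = x
  rw [card_neighborBlocks_inter]
  constructor
  · exact fun hadj => ⟨fun h => hadj.ne (congrArg Subtype.val h), h.inter_adj i i.2 j j.2 hadj⟩
  · rintro ⟨hne, hc⟩
    by_contra hadj
    rw [h.inter_not_adj i i.2 j j.2 (fun h => hne (Subtype.ext h)) hadj] at hc
    exact hxy hc.symm

/-! ### The blocks of the identity for `A²` -/

section Spectrum

variable {θ₁ θ₂ ε a₁ a₂ : ℝ} {a : V → ℝ}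

theorem mul_self_add_eq (h : TwoFibreGraph Γ P Q k₁ k₂ k₁₁ k₁₂ k₂₁ k₂₂ lam x y)
    (ha : ∀ u v, (Γ.adjMatrix ℝ * Γ.adjMatrix ℝ) u v =
      (θ₁ + θ₂) * Γ.adjMatrix ℝ u v - θ₁ * θ₂ * (1 : Matrix V V ℝ) u v + a u * a v)
    (ha₂ : ∀ u ∈ Q, a u = a₂) :
    (Γ.induce (Q : Set V)).adjMatrix ℝ * (Γ.induce (Q : Set V)).adjMatrix ℝ +
        (incidenceMatrix (neighborBlocks Γ P Q))ᵀ * incidenceMatrix (neighborBlocks Γ P Q) =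
      (θ₁ + θ₂) • (Γ.induce (Q : Set V)).adjMatrix ℝ - (θ₁ * θ₂) • (1 : Matrix Q Q ℝ) +
        (a₂ * a₂) • (Matrix.of fun _ _ => 1) := by
  ext (i : Q) (j : Q)
  have h1 := ha i j
  rw [Matrix.mul_apply, sum_eq_sum_add_sum_of_cover h.disjoint h.cover, ha₂ i i.2, ha₂ j j.2]
    at h1
  have h2 : (1 : Matrix V V ℝ) i j = (1 : Matrix Q Q ℝ) i j := by
    rw [Matrix.one_apply, Matrix.one_apply]
    exact if_congr Subtype.ext_iff.symm rfl rfl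
  have h3 : ((incidenceMatrix (neighborBlocks Γ P Q))ᵀ *
      incidenceMatrix (neighborBlocks Γ P Q)) i j =
        ∑ z ∈ P, Γ.adjMatrix ℝ i z * Γ.adjMatrix ℝ z j := by
    rw [Matrix.mul_apply]
    refine Eq.trans (Finset.sum_congr rfl fun z _ => ?_)
      (Finset.sum_coe_sort P fun z => Γ.adjMatrix ℝ i z * Γ.adjMatrix ℝ z j)
    rw [Matrix.transpose_apply, incidenceMatrix_apply, incidenceMatrix_apply,
      Γ.isSymm_adjMatrix.apply]
  have h4 : ((Γ.induce (Q : Set V)).adjMatrix ℝ * (Γ.induce (Q : Set V)).adjMatrix ℝ) i j =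
      ∑ z ∈ Q, Γ.adjMatrix ℝ i z * Γ.adjMatrix ℝ z j := by
    rw [Matrix.mul_apply]
    exact Finset.sum_coe_sort Q fun z => Γ.adjMatrix ℝ i z * Γ.adjMatrix ℝ z j
  have h5 : (Γ.induce (Q : Set V)).adjMatrix ℝ i j = Γ.adjMatrix ℝ i j := rfl
  simp only [Matrix.add_apply, Matrix.sub_apply, Matrix.smul_apply, Matrix.of_apply, smul_eq_mul]
  rw [h3, h4, h5, ← h2]
  linarith

/-- In the block `P × Q` the contribution of `P` is `ε(J - I)M = ε k₂₁ J - ε M`; moving it to the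
right gives the coefficients. -/
theorem mul_induce_eq (h : TwoFibreGraph Γ P Q k₁ k₂ k₁₁ k₁₂ k₂₁ k₂₂ lam x y)
    (ha : ∀ u v, (Γ.adjMatrix ℝ * Γ.adjMatrix ℝ) u v =
      (θ₁ + θ₂) * Γ.adjMatrix ℝ u v - θ₁ * θ₂ * (1 : Matrix V V ℝ) u v + a u * a v)
    (ha₁ : ∀ u ∈ P, a u = a₁) (ha₂ : ∀ u ∈ Q, a u = a₂)
    (hε : ∀ u ∈ P, ∀ w ∈ P, u ≠ w → Γ.adjMatrix ℝ u w = ε) :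
    incidenceMatrix (neighborBlocks Γ P Q) * (Γ.induce (Q : Set V)).adjMatrix ℝ =
      (θ₁ + θ₂ + ε) • incidenceMatrix (neighborBlocks Γ P Q) +
        (a₁ * a₂ - ε * k₂₁) • (Matrix.of fun _ _ => 1) := by
  ext p (j : Q)
  have hpj : (p : V) ≠ j := fun h' => Finset.disjoint_left.1 h.disjoint p.2 (h' ▸ j.2)
  have h1 := ha p j
  rw [Matrix.mul_apply, sum_eq_sum_add_sum_of_cover h.disjoint h.cover, ha₁ p p.2, ha₂ j j.2,
    Matrix.one_apply_ne hpj] at h1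
  have h3 : ∑ z ∈ P, Γ.adjMatrix ℝ p z * Γ.adjMatrix ℝ z j =
      ε * k₂₁ - ε * Γ.adjMatrix ℝ p j := by
    have hz : ∀ z ∈ P, Γ.adjMatrix ℝ p z * Γ.adjMatrix ℝ z j =
        ε * Γ.adjMatrix ℝ z j - if z = p then ε * Γ.adjMatrix ℝ z j else 0 := by
      intro z hz
      split_ifs with hzp
      · subst hzp
        simp
      · rw [hε p p.2 z hz (Ne.symm hzp), sub_zero]
    rw [Finset.sum_congr rfl hz, Finset.sum_sub_distrib, Finset.sum_ite_eq', if_pos p.2,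
      ← Finset.mul_sum, ← h.sum_col j, ← Finset.sum_coe_sort]
    simp only [incidenceMatrix_apply]
  have h4 : (incidenceMatrix (neighborBlocks Γ P Q) * (Γ.induce (Q : Set V)).adjMatrix ℝ) p j =
      ∑ z ∈ Q, Γ.adjMatrix ℝ p z * Γ.adjMatrix ℝ z j := by
    rw [Matrix.mul_apply]
    refine Eq.trans (Finset.sum_congr rfl fun z _ => ?_)
      (Finset.sum_coe_sort Q fun z => Γ.adjMatrix ℝ p z * Γ.adjMatrix ℝ z j)
    rw [incidenceMatrix_apply]
    rfl
  simp only [Matrix.add_apply, Matrix.smul_apply, Matrix.of_apply, smul_eq_mul]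
  rw [h4, incidenceMatrix_apply]
  linarith

/-- The difference of an off-diagonal and a diagonal entry in the block `P × P` eliminates both
`a₁²` and `|P|`. -/
theorem lam_sub_eq (h : TwoFibreGraph Γ P Q k₁ k₂ k₁₁ k₁₂ k₂₁ k₂₂ lam x y)
    (ha : ∀ u v, (Γ.adjMatrix ℝ * Γ.adjMatrix ℝ) u v =
      (θ₁ + θ₂) * Γ.adjMatrix ℝ u v - θ₁ * θ₂ * (1 : Matrix V V ℝ) u v + a u * a v)
    (ha₁ : ∀ u ∈ P, a u = a₁) (hε01 : ε = 0 ∨ ε = 1)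
    (hε : ∀ u ∈ P, ∀ w ∈ P, u ≠ w → Γ.adjMatrix ℝ u w = ε) :
    (lam : ℝ) - k₁₂ = (θ₁ + ε) * (θ₂ + ε) := by
  have hentry : ∀ u ∈ P, ∀ z ∈ P, Γ.adjMatrix ℝ u z = if z = u then 0 else ε := by
    intro u hu z hz
    split_ifs with hzu
    · simp [hzu]
    · exact hε u hu z hz (Ne.symm hzu)
  have hentry' : ∀ u ∈ P, ∀ z ∈ P, Γ.adjMatrix ℝ z u = if z = u then 0 else ε := by
    intro u hu z hz
    rw [← hentry u hu z hz]
    simp only [SimpleGraph.adjMatrix_apply, Γ.adj_comm]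
  obtain ⟨u, hu, w, hw, hne⟩ := h.exists_ne
  have h1 := ha u u
  rw [Matrix.mul_apply, sum_eq_sum_add_sum_of_cover h.disjoint h.cover,
    SimpleGraph.sum_adjMatrix_mul_adjMatrix Γ Q, Finset.inter_self, h.card₁₂ u hu,
    ha₁ u hu, Matrix.one_apply_eq, hentry u hu u hu, if_pos rfl] at h1
  have h2 := ha u w
  rw [Matrix.mul_apply, sum_eq_sum_add_sum_of_cover h.disjoint h.cover,
    SimpleGraph.sum_adjMatrix_mul_adjMatrix Γ Q, h.inter₁ u hu w hw hne,
    ha₁ u hu, ha₁ w hw, Matrix.one_apply_ne hne, hε u hu w hw hne,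
    sum_mul_of_offDiag hu hw hne (hentry u hu) (hentry' w hw)] at h2
  have h3 : ∑ z ∈ P, Γ.adjMatrix ℝ u z * Γ.adjMatrix ℝ z u = P.card * (ε * ε) - ε * ε := by
    have hz : ∀ z ∈ P, Γ.adjMatrix ℝ u z * Γ.adjMatrix ℝ z u =
        ε * ε - if z = u then ε * ε else 0 := by
      intro z hz
      rw [hentry u hu z hz, hentry' u hu z hz]
      split_ifs <;> ring
    rw [Finset.sum_congr rfl hz, Finset.sum_sub_distrib, Finset.sum_ite_eq', if_pos hu,
      Finset.sum_const, nsmul_eq_mul]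
  rw [h3] at h1
  rcases hε01 with rfl | rfl <;> linarith

theorem lam_le (h : TwoFibreGraph Γ P Q k₁ k₂ k₁₁ k₁₂ k₂₁ k₂₂ lam x y) : lam ≤ k₁₂ := by
  obtain ⟨u, hu, w, hw, hne⟩ := h.exists_ne
  rw [← h.inter₁ u hu w hw hne, ← h.card₁₂ u hu]
  exact Finset.card_le_card (Finset.inter_subset_inter_right Finset.inter_subset_left)

end Spectrum

end TwoFibreGraph

/-! ### Assembly of the theorem -/

/-- After substitution the two sides still carry different decidability instances, so the equality
is not definitional. -/
theorem restrictedEigenvalues_congr {W : Type*} [Fintype W] {G H : SimpleGraph W}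
    [DecidableRel G.Adj] [DecidableRel H.Adj] (h : G = H) :
    restrictedEigenvalues G = restrictedEigenvalues H := by
  subst h
  congr!

theorem theorem5p6 {V : Type*} [Fintype V] [DecidableEq V] (Γ : SimpleGraph V)
    [DecidableRel Γ.Adj] (θ₀ θ₁ θ₂ : ℝ) (hΓ : InG3 Γ θ₀ θ₁ θ₂)
    (C : CoherentConfiguration V) (hC : C.IsConfigurationOf (coherentClosure Γ))
    (F : Fin 2 → Finset V) (hT : C.HasType F !![2, 2; 2, 3]) :
    ∃ k₁ k₂ k₁₁ k₁₂ k₂₁ k₂₂ : ℕ,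
      -- the fibres are the classes of the valency partition, which is equitable
      IsBiregular Γ (F 0) (F 1) k₁ k₂ ∧
      IsEquitableWith Γ F !![k₁₁, k₁₂; k₂₁, k₂₂] ∧
      ∃ (ε : ℝ) (blk : F 1 → Finset (F 0)) (lam x y : ℕ),
        (ε = 0 ∨ ε = 1) ∧
        -- the adjacency matrix in block form
        (Γ.adjMatrix ℝ).submatrix
            (Sum.elim Subtype.val Subtype.val : F 0 ⊕ F 1 → V)
            (Sum.elim Subtype.val Subtype.val : F 0 ⊕ F 1 → V) =
          Matrix.fromBlocks (ε • (Matrix.of (fun _ _ => 1) - 1)) (incidenceMatrix blk)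
            (incidenceMatrix blk)ᵀ ((Γ.induce (F 1 : Set V)).adjMatrix ℝ) ∧
        IsQSD blk (F 0).card k₂₁ lam (F 1).card k₁₂ x y ∧
        Γ.induce (F 1 : Set V) = blockGraph blk x ∧
        ∃ e₁ e₂ : ℝ,
          e₂ < e₁ ∧ restrictedEigenvalues (blockGraph blk x) = {e₁, e₂} ∧
          ((θ₁ = e₁ ∧ e₁ = ((y : ℝ) - k₂₁) / ((x : ℝ) - y)) ∨
            (θ₂ = e₂ ∧ e₂ = ((y : ℝ) - k₂₁) / ((x : ℝ) - y))) ∧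
          (x : ℝ) = k₂₁ + (θ₁ + 1) * (θ₂ + 1) - (e₁ + 1) * (e₂ + 1) ∧
          (y : ℝ) = k₂₁ + θ₁ * θ₂ - e₁ * e₂ ∧
          0 < (k₁ : ℝ) + θ₁ * θ₂ ∧ 0 < (k₂ : ℝ) + θ₁ * θ₂ ∧
          -- the first fibre induces an empty graph
          (Γ.induce (F 0 : Set V) = ⊥ →
            (lam : ℝ) - k₁₂ = θ₁ * θ₂ ∧
            ((k₁₂ : ℝ) - lam + y - k₂₁) / ((x : ℝ) - y) = θ₁ + θ₂ ∧
            Real.sqrt ((k₁ + θ₁ * θ₂) * (k₂ + θ₁ * θ₂)) =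
              ((lam : ℝ) * k₂₁ - y * k₁₂) / ((x : ℝ) - y)) ∧
          -- the first fibre induces a complete graph
          (Γ.induce (F 0 : Set V) = ⊤ →
            (lam : ℝ) - k₁₂ = (θ₁ + 1) * (θ₂ + 1) ∧
            ((k₁₂ : ℝ) - lam + y - k₂₁) / ((x : ℝ) - y) = θ₁ + θ₂ + 1 ∧
            Real.sqrt ((k₁ + θ₁ * θ₂) * (k₂ + θ₁ * θ₂)) =
              k₂₁ + ((lam : ℝ) * k₂₁ - y * k₁₂) / ((x : ℝ) - y)) := by
  obtain ⟨a, hpos, ha⟩ := hΓ.exists_pos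
  obtain ⟨k₁, k₂, k₁₁, k₁₂, k₂₁, k₂₂, lam, x, y, h⟩ := exists_twoFibreGraph hpos ha hC hT
  obtain ⟨ε, hε01, hε⟩ := h.exists_adjMatrix_eq
  obtain ⟨p, hp, p', hp', hpp⟩ := h.exists_ne
  obtain ⟨b, hb, c, hc, hbc⟩ := h.exists_adj₂₂
  obtain ⟨b', hb', c', hc', hbc', hnbc⟩ := h.exists_not_adj₂₂
  obtain ⟨d, hd, f, hf, hdf⟩ := h.exists_adj₁₂
  obtain ⟨d', hd', f', hf', hndf⟩ := h.exists_not_adj₁₂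
  have hconst : ∀ {u w}, Γ.degree u = Γ.degree w → a u = a w := by
    intro u w huw
    have h1 := degree_eq_of_pos_vector ha u
    rw [huw, degree_eq_of_pos_vector ha w] at h1
    exact ((mul_self_inj (hpos w).le (hpos u).le).1 h1).symm
  have ha₁ : ∀ u ∈ F 0, a u = a p := fun u hu =>
    hconst ((h.degree₁ u hu).trans (h.degree₁ p hp).symm)
  have ha₂ : ∀ u ∈ F 1, a u = a b := fun u hu =>
    hconst ((h.degree₂ u hu).trans (h.degree₂ b hb).symm)
  have hk₁ : (k₁ : ℝ) + θ₁ * θ₂ = a p * a p := by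
    rw [← degree_eq_of_pos_vector ha p, h.degree₁ p hp]
  have hk₂ : (k₂ : ℝ) + θ₁ * θ₂ = a b * a b := by
    rw [← degree_eq_of_pos_vector ha b, h.degree₂ b hb]
  have hsqrt : Real.sqrt ((k₁ + θ₁ * θ₂) * (k₂ + θ₁ * θ₂)) = a p * a b := by
    rw [hk₁, hk₂, show a p * a p * (a b * a b) = (a p * a b) * (a p * a b) by ring]
    exact Real.sqrt_mul_self (mul_pos (hpos p) (hpos b)).le
  have hMB := h.mul_induce_eq ha ha₁ ha₂ hε
  have hxy := h.intersection_ne hMB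
  have hxyR : (x : ℝ) ≠ y := by exact_mod_cast hxy
  have hxy0 : (x : ℝ) - y ≠ 0 := sub_ne_zero.2 hxyR
  have hlam := h.lam_sub_eq ha ha₁ hε01 hε
  -- Two points lie on at most as many common blocks as one point does. This sign decides below
  -- which `θ` each `e` can equal.
  have hlam0 : (θ₁ + ε) * (θ₂ + ε) ≤ 0 := by
    have : (lam : ℝ) ≤ k₁₂ := by exact_mod_cast h.lam_le
    linarith
  have hsq := h.mul_self_add_eq ha ha₂
  obtain ⟨hpar₁, hpar₂⟩ := block_parameter_equations h.sum_col h.sum_row h.mul_transpose_eq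
    h.transpose_mul_eq hMB (i := ⟨d, hd⟩) (j := ⟨f, hf⟩) (i' := ⟨d', hd'⟩) (j' := ⟨f', hf'⟩)
    (by rw [TwoFibreGraph.incidenceMatrix_apply]; simp [hdf])
    (by rw [TwoFibreGraph.incidenceMatrix_apply]; simp [hndf])
  set B := (Γ.induce (F 1 : Set V)).adjMatrix ℝ
  have hB : B * B = (θ₁ + θ₂ - x + y) • B + (-(θ₁ * θ₂) - (k₂₁ - y)) • (1 : Matrix (F 1) (F 1) ℝ) +
      (a b * a b - y) • (Matrix.of fun _ _ => 1) := by
    rw [eq_sub_of_add_eq hsq, h.transpose_mul_eq]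
    module
  -- `hadd` and `hmul` are the relations between the roots and the coefficients in `hB`; the
  -- formulas for `x` and `y` follow linearly from them.
  obtain ⟨e₁, e₂, hlt, hadd, hmul, hres⟩ := exists_two_restricted_eigenvalues
    (SimpleGraph.isSymm_adjMatrix _) h.sum_col_induce hB
    (i := ⟨b, hb⟩) (j := ⟨c, hc⟩) (i' := ⟨b', hb'⟩) (j' := ⟨c', hc'⟩)
    (fun h => hbc.ne (congrArg Subtype.val h)) (fun h => hbc' (congrArg Subtype.val h))
    (by simp [hbc, hnbc])
  have hcases : ∀ e, e = e₁ ∨ e = e₂ →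
      (e = ((y : ℝ) - k₂₁) / ((x : ℝ) - y) ∧ (e = θ₁ ∨ e = θ₂)) ∨ e = θ₁ + θ₂ + ε := by
    intro e he
    have hmem : e ∈ ({e₁, e₂} : Set ℝ) := he
    rw [← hres] at hmem
    obtain ⟨u, hu, hu0, hue⟩ := hmem
    exact restricted_eigenvalue_cases hxyR h.sum_col h.mul_transpose_eq h.transpose_mul_eq hsq
      hpar₂ hu hu0 hue
  have hθ := hΓ.lt₁₂
  refine ⟨k₁, k₂, k₁₁, k₁₂, k₂₁, k₂₂, ?_, ?_, ε, neighborBlocks Γ (F 0) (F 1), lam, x, y, hε01,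
    ?_, h.isQSD hxy, h.induce_eq_blockGraph hxy, e₁, e₂, hlt, ?_, ?_, by linarith,
    by linarith, by rw [hk₁]; exact mul_pos (hpos p) (hpos p),
    by rw [hk₂]; exact mul_pos (hpos b) (hpos b), ?_, ?_⟩
  · refine ⟨h.ne, ⟨p, hp⟩, ⟨b, hb⟩, h.cover, fun u => ⟨h.degree₁ u, fun hu => ?_⟩,
      fun u => ⟨h.degree₂ u, fun hu => ?_⟩⟩
    · exact (h.cover u).resolve_right fun hu' => h.ne (hu.symm.trans (h.degree₂ u hu'))
    · exact (h.cover u).resolve_left fun hu' => h.ne ((h.degree₁ u hu').symm.trans hu)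
  · intro i j
    fin_cases i <;> fin_cases j
    · exact h.card₁₁
    · exact h.card₁₂
    · exact h.card₂₁
    · exact h.card₂₂
  · ext (i | i) (j | j)
    · by_cases hij : i = j
      · subst hij
        simp
      · have := hε i i.2 j j.2 fun h => hij (Subtype.ext h)
        rw [Matrix.submatrix_apply, Matrix.fromBlocks_apply₁₁]
        simpa [Matrix.one_apply_ne hij] using this
    · exact (TwoFibreGraph.incidenceMatrix_apply i j).symm
    · rw [Matrix.fromBlocks_apply₂₁, Matrix.transpose_apply, TwoFibreGraph.incidenceMatrix_apply]
      exact Γ.isSymm_adjMatrix.apply _ _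
    · rfl
  · rw [← hres]
    exact restrictedEigenvalues_congr (h.induce_eq_blockGraph hxy).symm
  -- As `e₁ ≠ e₂`, exactly one of them is `(y - k₂₁)/(x - y)` and the other is `θ₁ + θ₂ + ε`. If `e₁
  -- = θ₂`, then `e₂ < e₁` makes `θ₁ + ε` and `θ₂ + ε` both negative; if `e₂ = θ₁`, both are
  -- positive. Either contradicts `hlam0`.
  · rcases hcases e₁ (Or.inl rfl) with ⟨h1, h1'⟩ | h1
    · rcases hcases e₂ (Or.inr rfl) with ⟨h2, -⟩ | h2
      · exact absurd (h2.trans h1.symm) hlt.ne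
      rcases h1' with h3 | h3
      · exact Or.inl ⟨h3.symm, h1⟩
      · have h4 : θ₁ + ε < 0 := by linarith
        have h5 : θ₂ + ε < 0 := by linarith
        exact absurd (mul_pos_of_neg_of_neg h4 h5) (not_lt.2 hlam0)
    · rcases hcases e₂ (Or.inr rfl) with ⟨h2, h2'⟩ | h2
      · rcases h2' with h3 | h3
        · have h4 : 0 < θ₂ + ε := by linarith
          have h5 : 0 < θ₁ + ε := by linarith
          exact absurd (mul_pos h5 h4) (not_lt.2 hlam0)
        · exact Or.inr ⟨h3.symm, h2⟩
      · exact absurd (h2.trans h1.symm) hlt.ne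
  · intro hbot
    have hε0 : ε = 0 := by
      rw [← hε p hp p' hp' hpp]
      have hn : ¬ Γ.Adj p p' := by
        intro hadj
        have hadj' : (Γ.induce (F 0 : Set V)).Adj ⟨p, hp⟩ ⟨p', hp'⟩ := hadj
        rw [hbot] at hadj'
        exact hadj'
      rw [SimpleGraph.adjMatrix_apply, if_neg hn]
    subst hε0
    refine ⟨by rw [hlam]; ring, ?_, ?_⟩
    · rw [div_eq_iff hxy0]
      linarith
    · rw [hsqrt, eq_div_iff hxy0]
      linarith
  · intro htop
    have hε1 : ε = 1 := by
      rw [← hε p hp p' hp' hpp]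
      have hn : Γ.Adj p p' := by
        have hadj' : (Γ.induce (F 0 : Set V)).Adj ⟨p, hp⟩ ⟨p', hp'⟩ := by
          rw [htop]
          exact fun h => hpp (congrArg Subtype.val h)
        exact hadj'
      rw [SimpleGraph.adjMatrix_apply, if_pos hn]
    subst hε1
    refine ⟨hlam, ?_, ?_⟩
    · rw [div_eq_iff hxy0]
      linarith
    · rw [hsqrt, ← sub_eq_iff_eq_add', eq_div_iff hxy0]
      linarith
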